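/- Let $E, E_*$ be separable complex Hilbert spaces and let $\Phi:\mathbb D^2\to\mathcal L(E,E_*)$ be holomorphic with $\|\Phi(z)\|\le 1$ for all $z\in\mathbb D^2$. Write $L^2(\cdot)$ for the vector-valued $L^2$ spaces on $\mathbb T^2$, identify $H^2(\cdot)$ on $\mathbb D^2$ with $L^2_{++}(\cdot)$, the functions with Fourier support in $\{n_1,n_2\ge 0\}$, and write $\Phi$ also for multiplication by the boundary values of $\Phi$. Let $L^2_{+-}(E)$ (resp. $L^2_{-+}(E)$) be the functions with Fourier support in $\{n_1\ge 0,\,n_2<0\}$ (resp. $\{n_1<0,\,n_2\ge0\}$). The operator range $\mathcal M(T)$ of a bounded operator $T$ is its image with inner product $\langle Tx,Ty\rangle_{\mathcal M(T)}=\langle P_{(\ker T)^\perp}x,y\rangle$. Let $\mathscr H=\mathcal M\big(\begin{bmatrix} I&\Phi\\ \Phi^*&I\end{bmatrix}^{1/2}\big)\subseteq L^2(E_*)\oplus L^2(E)$, on which $Z_1,Z_2$ (multiplication by the coordinates) act as unitaries, and let $$\mathcal K_\Phi=\mathscr H\ominus\Big(\begin{bmatrix}\Phi\\ I\end{bmatrix}H^2(E)\oplus\begin{bmatrix}I\\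 \Phi^*\end{bmatrix}\big(L^2(E_*)\ominus H^2(E_*)\big)\Big),$$ with orthogonal projection $P_\Phi:\mathscr H\to\mathcal K_\Phi$. For $j=1,2$ put $$S_j^{max}=\{F\in\mathcal K_\Phi: Z_j^kF\in\mathcal K_\Phi\ \text{for all } k\ge 0\},\qquad S_1^{min}=\overline{P_\Phi\begin{bmatrix}\Phi\\ I\end{bmatrix}L^2_{+-}(E)},\qquad S_2^{min}=\overline{P_\Phi\begin{bmatrix}\Phi\\ I\end{bmatrix}L^2_{-+}(E)},$$ and $\mathcal R=S_1^{max}\ominus S_1^{min}$. Let $\mathcal H_\Phi$ be the operator range of $(I-\Phi P_{H^2(E)}\Phi^*)^{1/2}$ (the operator being compressed to $H^2(E_*)$), regarded as a space of functions on $\mathbb D^2$. Then: 1. $\mathcal H_\Phi$ is the reproducing kernel Hilbert space with the de Branges–Rovnyak kernel $\dfrac{I-\Phi(z)\Phi(w)^*}{(1-z_1\bar w_1)(1-z_2\bar w_2)}$. 2. There is an isometry $V:\mathcal H_\Phi\to\mathcal K_\Phi$ such that the first component of $Vf$ is $f$ for all $f\in\mathcal H_\Phi$, and $V^*\begin{bmatrix}f\\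 g\end{bmatrix}=f$ for all $\begin{bmatrix}f\\ g\end{bmatrix}\in\mathcal K_\Phi$, and the following holds for it. Let $K_j^{max}$, $K_j^{min}$ and $G$ be the reproducing kernels of the operator ranges of $V^*$ restricted to $S_j^{max}\ominus Z_jS_j^{max}$, to $S_j^{min}\ominus Z_jS_j^{min}$ and to $\mathcal R$, respectively. Then $(K_1^{max},K_2^{min})$ and $(K_1^{min},K_2^{max})$ are both Agler kernels of $\Phi$; here positive kernels $(K_1,K_2)$ are Agler kernels of $\Phi$ if $I-\Phi(z)\Phi(w)^*=(1-z_1\bar w_1)K_2(z,w)+(1-z_2\bar w_2)K_1(z,w)$ for all $z,w\in\mathbb D^2$. Moreover, for all $z,w\in\mathbb D^2$, $$\frac{I-\Phi(z)\Phi(w)^*}{(1-z_1\bar w_1)(1-z_2\bar w_2)}=\frac{K_1^{max}(z,w)}{1-z_1\bar w_1}+\frac{K_2^{min}(z,w)}{1-z_2\bar w_2}=\frac{K_1^{min}(z,w)}{1-z_1\bar w_1}+\frac{K_2^{max}(z,w)}{1-z_2\bar w_2},$$ and $$\frac{I-\Phi(z)\Phi(w)^*}{(1-z_1\bar w_1)(1-z_2\bar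 w_2)}=\frac{K_1^{min}(z,w)}{1-z_1\bar w_1}+\frac{K_2^{min}(z,w)}{1-z_2\bar w_2}+G(z,w).$$ -/

import Mathlib

set_option linter.unusedSectionVars false

open MeasureTheory Filter Topology InnerProductSpace
open scoped ENNReal ComplexOrder ComplexConjugate

noncomputable section

namespace AglerDecomp

/-! ### Operator ranges -/

section OperatorRange

variable {H Y : Type*} [NormedAddCommGroup H] [InnerProductSpace ℂ H]
  [AddCommGroup Y] [Module ℂ Y] [TopologicalSpace Y]

/-- The operator range `M(T)` of a bounded operator `T : H → Y`: the image of `T` with the Hilbert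
space structure `⟪T x, T y⟫ = ⟪P x, y⟫`, where `P` is the projection onto `(ker T)ᗮ`.
The element `T x` is stored as its unique preimage `P x` in `(ker T)ᗮ`;
the inclusion of `M(T)` in `Y` is `OperatorRange.incl`. -/
def OperatorRange (T : H →L[ℂ] Y) : Type _ := ↥(LinearMap.ker T.toLinearMap)ᗮ

namespace OperatorRange

variable (T : H →L[ℂ] Y)

instance : NormedAddCommGroup (OperatorRange T) :=
  inferInstanceAs (NormedAddCommGroup ↥(LinearMap.ker T.toLinearMap)ᗮ)

instance : InnerProductSpace ℂ (OperatorRange T) :=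
  inferInstanceAs (InnerProductSpace ℂ ↥(LinearMap.ker T.toLinearMap)ᗮ)

instance [CompleteSpace H] : CompleteSpace (OperatorRange T) :=
  inferInstanceAs (CompleteSpace ↥(LinearMap.ker T.toLinearMap)ᗮ)

/-- The stored preimage in `(ker T)ᗮ`. -/
def preimage : OperatorRange T →L[ℂ] H := (LinearMap.ker T.toLinearMap)ᗮ.subtypeL

/-- The inclusion of the operator range `M(T)` in the target space of `T`. -/
def incl : OperatorRange T →L[ℂ] Y := T ∘L preimage T

/-- The element `T x` of the operator range `M(T)`. -/
def mk [CompleteSpace H] : H →L[ℂ] OperatorRange T :=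
  (LinearMap.ker T.toLinearMap)ᗮ.orthogonalProjectionOnto

theorem incl_injective : Function.Injective (incl T) := by
  refine (injective_iff_map_eq_zero _).2 fun x hx => ?_
  have h1 : (preimage T x) ∈ LinearMap.ker T.toLinearMap := hx
  have h2 : (preimage T x) ∈ (LinearMap.ker T.toLinearMap)ᗮ := Subtype.property x
  have h3 : preimage T x = 0 := inner_self_eq_zero.1 (h2 _ h1)
  exact Subtype.ext h3

theorem incl_mk [CompleteSpace H] [T1Space Y] (x : H) : incl T (mk T x) = T x := by
  have hcl : IsClosed ((LinearMap.ker T.toLinearMap : Submodule ℂ H) : Set H) :=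
    T.isClosed_ker
  have : CompleteSpace (LinearMap.ker T.toLinearMap) := hcl.completeSpace_coe
  have h : x - (LinearMap.ker T.toLinearMap)ᗮ.starProjection x ∈
      (LinearMap.ker T.toLinearMap)ᗮᗮ :=
    Submodule.sub_starProjection_mem_orthogonal x
  rw [Submodule.orthogonal_orthogonal] at h
  have h2 : T (x - (LinearMap.ker T.toLinearMap)ᗮ.starProjection x) = 0 := h
  rw [map_sub, sub_eq_zero] at h2
  exact h2.symm

theorem inner_mk_mk [CompleteSpace H] (x y : H) :
    inner ℂ (mk T x) (mk T y) =
      inner ℂ ((LinearMap.ker T.toLinearMap)ᗮ.starProjection x) y :=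
  Submodule.inner_orthogonalProjectionOnto_eq_of_mem_left _ _

end OperatorRange

/-- The operator range of a bounded operator into a space of functions is a reproducing kernel
Hilbert space. -/
instance {X V : Type*} [NormedAddCommGroup V] [InnerProductSpace ℂ V] (T : H →L[ℂ] (X → V)) :
    RKHS ℂ (OperatorRange T) X V where
  coeCLM := OperatorRange.incl T
  coeCLM_injective := OperatorRange.incl_injective T

end OperatorRange

section Sqrt

variable {H : Type*} [NormedAddCommGroup H] [InnerProductSpace ℂ H] [CompleteSpace H]

/-- The positive square root of a positive operator on a Hilbert space. -/
def opSqrt (A : H →L[ℂ] H) : H →L[ℂ] H := CFC.sqrt A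

theorem opSqrt_commute (A B : H →L[ℂ] H) (h : ∀ x, A (B x) = B (A x)) (x : H) :
    opSqrt A (B x) = B (opSqrt A x) := by
  have h1 : Commute A B := ContinuousLinearMap.ext h
  exact congrArg (fun C : H →L[ℂ] H => C x) (h1.cfcₙ_nnreal NNReal.sqrt)

end Sqrt

/-! ### The bidisk, the Schur class and Agler kernels -/

/-- The open unit bidisk. -/
abbrev Bidisk : Type := {z : Fin 2 → ℂ // ∀ j, ‖z j‖ < 1}

section Kernels

variable {E Es : Type*} [NormedAddCommGroup E] [InnerProductSpace ℂ E] [CompleteSpace E]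
  [NormedAddCommGroup Es] [InnerProductSpace ℂ Es] [CompleteSpace Es]

/-- The two-variable Schur class: holomorphic contraction-valued functions on the bidisk. -/
structure IsSchur (Φ : (Fin 2 → ℂ) → (E →L[ℂ] Es)) : Prop where
  holomorphic : DifferentiableOn ℂ Φ {z | ∀ j, ‖z j‖ < 1}
  contractive : ∀ z : Fin 2 → ℂ, (∀ j, ‖z j‖ < 1) → ‖Φ z‖ ≤ 1

/-- Positive kernels on the set `X` with values in the operators on `V`. -/
def IsPositiveKernel {X V : Type*} [NormedAddCommGroup V] [InnerProductSpace ℂ V]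
    (K : X → X → (V →L[ℂ] V)) : Prop :=
  ∀ (N : ℕ) (x : Fin N → X) (η : Fin N → V),
    0 ≤ ∑ i, ∑ j, inner ℂ (η i) (K (x i) (x j) (η j))

/-- `(K₁, K₂)` are Agler kernels of `Φ`. -/
def IsAglerKernels (Φ : (Fin 2 → ℂ) → (E →L[ℂ] Es)) (K₁ K₂ : Bidisk → Bidisk → (Es →L[ℂ] Es)) :
    Prop :=
  IsPositiveKernel K₁ ∧ IsPositiveKernel K₂ ∧
    ∀ z w : Bidisk, 1 - Φ z.1 ∘L (Φ w.1).adjoint =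
      (1 - z.1 0 * conj (w.1 0)) • K₂ z w + (1 - z.1 1 * conj (w.1 1)) • K₁ z w

/-- The de Branges–Rovnyak kernel `(I - Φ(z)Φ(w)*) / ((1 - z₁ w̄₁)(1 - z₂ w̄₂))`. -/
def dBRKernel (Φ : (Fin 2 → ℂ) → (E →L[ℂ] Es)) (z w : Bidisk) : Es →L[ℂ] Es :=
  ((1 - z.1 0 * conj (w.1 0)) * (1 - z.1 1 * conj (w.1 1)))⁻¹ •
    (1 - Φ z.1 ∘L (Φ w.1).adjoint)

end Kernels

/-! ### The space `L²(E)` on the two-torus -/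

/-- The two-torus, `x` standing for the point `(exp (2πi x₁), exp (2πi x₂))`. -/
abbrev Torus : Type := UnitAddTorus (Fin 2)

/-- The normalised Lebesgue measure on the two-torus. -/
abbrev torusMeasure : Measure Torus := Measure.pi fun _ => AddCircle.haarAddCircle

/-- The point of `ℂ²` corresponding to a point of the torus. -/
def torusPoint (ζ : Torus) : Fin 2 → ℂ := fun j => (AddCircle.toCircle (ζ j) : ℂ)

/-- `L²(E)`: square integrable `E`-valued functions on the two-torus. -/
abbrev L2 (E : Type*) [NormedAddCommGroup E] : Type _ := Lp E 2 torusMeasure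

section Lebesgue

variable (E : Type*) [NormedAddCommGroup E] [InnerProductSpace ℂ E] [CompleteSpace E]

/-- Multiplication by the monomial `ζ₁ ^ n₁ * ζ₂ ^ n₂` on `L²(E)`. -/
def mulMonomial (n : Fin 2 → ℤ) : L2 E →L[ℂ] L2 E :=
  (ContinuousLinearMap.lsmul ℂ ℂ : ℂ →L[ℂ] E →L[ℂ] E).holderL torusMeasure ∞ 2 2
    (ContinuousMap.toLp ∞ torusMeasure ℂ (UnitAddTorus.mFourier n))

theorem coeFn_mulMonomial (n : Fin 2 → ℤ) (f : L2 E) :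
    mulMonomial E n f =ᵐ[torusMeasure] fun ζ => UnitAddTorus.mFourier n ζ • f ζ := by
  have h1 := ContinuousLinearMap.coeFn_holder (r := 2)
    (ContinuousLinearMap.lsmul ℂ ℂ : ℂ →L[ℂ] E →L[ℂ] E)
    (ContinuousMap.toLp ∞ torusMeasure ℂ (UnitAddTorus.mFourier n)) f
  have h2 := ContinuousMap.coeFn_toLp (p := ∞) (𝕜 := ℂ) torusMeasure (UnitAddTorus.mFourier n)
  filter_upwards [h1, h2] with ζ h1 h2
  refine h1.trans ?_
  rw [h2]; rfl

/-- The Fourier coefficient `f ↦ f̂(n)` as a bounded operator. -/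
def coeff (n : Fin 2 → ℤ) : L2 E →L[ℂ] E :=
  (ContinuousLinearMap.lsmul ℂ ℂ : ℂ →L[ℂ] E →L[ℂ] E).lpPairing torusMeasure 2 2
    (ContinuousMap.toLp 2 torusMeasure ℂ (UnitAddTorus.mFourier (-n)))

theorem coeff_apply (n : Fin 2 → ℤ) (f : L2 E) :
    coeff E n f = UnitAddTorus.mFourierCoeff f n := by
  rw [coeff, ContinuousLinearMap.lpPairing_eq_integral]
  refine integral_congr_ae ?_
  filter_upwards [ContinuousMap.coeFn_toLp (p := 2) (𝕜 := ℂ) torusMeasure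
    (UnitAddTorus.mFourier (-n))] with ζ h
  rw [h]; rfl

/-- The functions in `L²(E)` whose Fourier coefficients are supported in `N`. -/
def supportedIn (N : Set (Fin 2 → ℤ)) : Submodule ℂ (L2 E) :=
  ⨅ n ∈ Nᶜ, LinearMap.ker (coeff E n).toLinearMap

theorem isClosed_supportedIn (N : Set (Fin 2 → ℤ)) :
    IsClosed (supportedIn E N : Set (L2 E)) := by
  rw [supportedIn]
  simp only [Submodule.coe_iInf]
  exact isClosed_iInter fun n => isClosed_iInter fun _ => (coeff E n).isClosed_ker

instance (N : Set (Fin 2 → ℤ)) : CompleteSpace (supportedIn E N) :=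
  (isClosed_supportedIn E N).completeSpace_coe

/-- `H²(E)`, as the subspace `L²₊₊(E)` of `L²(E)`. -/
abbrev H2 : Submodule ℂ (L2 E) := supportedIn E {n | ∀ i, 0 ≤ n i}

/-- `L²₊₋(E)` for `j = 0` and `L²₋₊(E)` for `j = 1`: the Fourier support is nonnegative in the
variable `j` and negative in the other variable. -/
abbrev mixed (j : Fin 2) : Submodule ℂ (L2 E) :=
  supportedIn E {n | 0 ≤ n j ∧ ∀ i, i ≠ j → n i < 0}

/-- The function on the bidisk whose Taylor coefficients are the Fourier coefficients with
nonnegative indices of an element of `L²(E)`. On `H²(E)` this is the identification of boundary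
functions with holomorphic functions. -/
def toBidisk : L2 E →L[ℂ] (Bidisk → E) :=
  ContinuousLinearMap.pi fun z => ∑' n : Fin 2 → ℕ,
    (∏ j, z.1 j ^ n j) • coeff E fun j => (n j : ℤ)

end Lebesgue

/-! ### Multiplication by `Φ` -/

section Multiplication

variable {E Es : Type*} [NormedAddCommGroup E] [InnerProductSpace ℂ E] [CompleteSpace E]
  [NormedAddCommGroup Es] [InnerProductSpace ℂ Es] [CompleteSpace Es]

/-- `T` is the operator of multiplication by the boundary values of `Φ`:
`T f` is the limit in `L²(Es)` of the functions `ζ ↦ Φ(r ζ) f(ζ)` as `r` increases to `1`. -/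
def IsBoundaryMul (Φ : (Fin 2 → ℂ) → (E →L[ℂ] Es)) (T : L2 E →L[ℂ] L2 Es) : Prop :=
  ∀ f : L2 E, Tendsto
    (fun r : ℝ => eLpNorm (fun ζ => Φ ((r : ℂ) • torusPoint ζ) (f ζ) - T f ζ) 2 torusMeasure)
    (𝓝[<] 1) (𝓝 0)

open scoped Classical in
/-- Multiplication by the boundary values of `Φ`, as an operator `L²(E) → L²(Es)`.
For a Schur function this limit operator exists, and it is unique by `IsBoundaryMul.unique`. -/
def boundaryMul (Φ : (Fin 2 → ℂ) → (E →L[ℂ] Es)) : L2 E →L[ℂ] L2 Es :=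
  if h : ∃ T, IsBoundaryMul Φ T then h.choose else 0

theorem aestronglyMeasurable_dilate {Φ : (Fin 2 → ℂ) → (E →L[ℂ] Es)} (hΦ : IsSchur Φ) {r : ℝ}
    (h0 : 0 < r) (h1 : r < 1) (f : L2 E) :
    AEStronglyMeasurable (fun ζ => Φ ((r : ℂ) • torusPoint ζ) (f ζ)) torusMeasure := by
  have hc : Continuous fun ζ : Torus => (r : ℂ) • torusPoint ζ := by
    unfold torusPoint
    fun_prop
  have hm : ∀ ζ : Torus, (r : ℂ) • torusPoint ζ ∈ {z : Fin 2 → ℂ | ∀ j, ‖z j‖ < 1} := by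
    intro ζ j
    have h2 : ‖(AddCircle.toCircle (ζ j) : ℂ)‖ = 1 := Circle.norm_coe _
    simpa [torusPoint, abs_of_pos h0, h2] using h1
  have hΦc : Continuous fun ζ : Torus => Φ ((r : ℂ) • torusPoint ζ) :=
    hΦ.holomorphic.continuousOn.comp_continuous hc hm
  exact isBoundedBilinearMap_apply.continuous.comp_aestronglyMeasurable
    (hΦc.aestronglyMeasurable.prodMk (Lp.aestronglyMeasurable f))

theorem eq_of_tendsto_eLpNorm {u : ℝ → Torus → E} {g h : L2 E}
    (hu : ∀ᶠ r in 𝓝[<] (1 : ℝ), AEStronglyMeasurable (u r) torusMeasure)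
    (hg : Tendsto (fun r => eLpNorm (fun ζ => u r ζ - g ζ) 2 torusMeasure) (𝓝[<] 1) (𝓝 0))
    (hh : Tendsto (fun r => eLpNorm (fun ζ => u r ζ - h ζ) 2 torusMeasure) (𝓝[<] 1) (𝓝 0)) :
    g = h := by
  have hle : eLpNorm (⇑g - ⇑h) 2 torusMeasure ≤ 0 + 0 := by
    refine ge_of_tendsto (hg.add hh) ?_
    filter_upwards [hu] with r hr
    have h1 : (⇑g - ⇑h : Torus → E) = (fun ζ => u r ζ - h ζ) - fun ζ => u r ζ - g ζ := by
      ext ζ; simp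
    rw [h1, add_comm]
    exact eLpNorm_sub_le (hr.sub (Lp.aestronglyMeasurable h))
      (hr.sub (Lp.aestronglyMeasurable g)) (by norm_num)
  rw [add_zero, nonpos_iff_eq_zero, eLpNorm_eq_zero_iff
    ((Lp.aestronglyMeasurable g).sub (Lp.aestronglyMeasurable h)) (by norm_num)] at hle
  refine Lp.ext ?_
  filter_upwards [hle] with ζ hζ
  exact sub_eq_zero.1 hζ

theorem eventually_measurable_dilate {Φ : (Fin 2 → ℂ) → (E →L[ℂ] Es)} (hΦ : IsSchur Φ)
    (f : L2 E) : ∀ᶠ r : ℝ in 𝓝[<] (1 : ℝ),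
      AEStronglyMeasurable (fun ζ => Φ ((r : ℂ) • torusPoint ζ) (f ζ)) torusMeasure := by
  filter_upwards [Ioo_mem_nhdsLT (show (0 : ℝ) < 1 by norm_num)] with r hr
  exact aestronglyMeasurable_dilate hΦ hr.1 hr.2 f

theorem IsBoundaryMul.unique {Φ : (Fin 2 → ℂ) → (E →L[ℂ] Es)} (hΦ : IsSchur Φ)
    {T T' : L2 E →L[ℂ] L2 Es} (hT : IsBoundaryMul Φ T) (hT' : IsBoundaryMul Φ T') : T = T' :=
  ContinuousLinearMap.ext fun f =>
    eq_of_tendsto_eLpNorm (eventually_measurable_dilate hΦ f) (hT f) (hT' f)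

theorem IsBoundaryMul.commute {Φ : (Fin 2 → ℂ) → (E →L[ℂ] Es)} (hΦ : IsSchur Φ)
    {T : L2 E →L[ℂ] L2 Es} (hT : IsBoundaryMul Φ T) (n : Fin 2 → ℤ) (f : L2 E) :
    T (mulMonomial E n f) = mulMonomial Es n (T f) := by
  refine eq_of_tendsto_eLpNorm (eventually_measurable_dilate hΦ _) (hT _) ?_
  refine (hT f).congr fun r => eLpNorm_congr_norm_ae ?_
  filter_upwards [coeFn_mulMonomial E n f, coeFn_mulMonomial Es n (T f)] with ζ h1 h2
  have h3 : ‖UnitAddTorus.mFourier n ζ‖ = 1 := by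
    simp only [UnitAddTorus.mFourier, fourier_apply, ContinuousMap.coe_mk, norm_prod,
      Circle.norm_coe, Finset.prod_const_one]
  rw [h1, h2, map_smul, ← smul_sub, norm_smul, h3, one_mul]

theorem boundaryMul_mulMonomial {Φ : (Fin 2 → ℂ) → (E →L[ℂ] Es)} (hΦ : IsSchur Φ)
    (n : Fin 2 → ℤ) (f : L2 E) :
    boundaryMul Φ (mulMonomial E n f) = mulMonomial Es n (boundaryMul Φ f) := by
  unfold boundaryMul
  split_ifs with h
  · exact h.choose_spec.commute hΦ n f
  · simp

theorem inner_mulMonomial (n : Fin 2 → ℤ) (f g : L2 E) :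
    inner ℂ f (mulMonomial E n g) = inner ℂ (mulMonomial E (-n) f) g := by
  rw [L2.inner_def, L2.inner_def]
  refine integral_congr_ae ?_
  filter_upwards [coeFn_mulMonomial E n g, coeFn_mulMonomial E (-n) f] with ζ h1 h2
  rw [h1, h2, inner_smul_left, inner_smul_right, UnitAddTorus.mFourier_neg, Complex.conj_conj]

theorem adjoint_boundaryMul_mulMonomial {Φ : (Fin 2 → ℂ) → (E →L[ℂ] Es)} (hΦ : IsSchur Φ)
    (n : Fin 2 → ℤ) (f : L2 Es) :
    (boundaryMul Φ).adjoint (mulMonomial Es n f) =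
      mulMonomial E n ((boundaryMul Φ).adjoint f) := by
  refine ext_inner_left ℂ fun g => ?_
  rw [ContinuousLinearMap.adjoint_inner_right, inner_mulMonomial, inner_mulMonomial,
    ContinuousLinearMap.adjoint_inner_right, boundaryMul_mulMonomial hΦ]

end Multiplication

/-! ### The de Branges–Rovnyak model -/

section Model

variable {E Es : Type*} [NormedAddCommGroup E] [InnerProductSpace ℂ E] [CompleteSpace E]
  [NormedAddCommGroup Es] [InnerProductSpace ℂ Es] [CompleteSpace Es]

variable (E Es) in
/-- The Hilbert space `L²(Es) ⊕ L²(E)`. -/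
abbrev L2Sum : Type _ := WithLp 2 (L2 Es × L2 E)

variable (E Es) in
/-- The operator of multiplication by `Z_j` on `L²(Es) ⊕ L²(E)`. -/
def mulZ (j : Fin 2) : L2Sum E Es →L[ℂ] L2Sum E Es :=
  (WithLp.prodContinuousLinearEquiv 2 ℂ (L2 Es) (L2 E)).symm.toContinuousLinearMap ∘L
    (mulMonomial Es (Pi.single j 1) ∘L WithLp.fstL 2 ℂ (L2 Es) (L2 E)).prod
      (mulMonomial E (Pi.single j 1) ∘L WithLp.sndL 2 ℂ (L2 Es) (L2 E))

variable (Φ : (Fin 2 → ℂ) → (E →L[ℂ] Es))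

/-- The operator with block matrix `[I, Φ; Φ*, I]` on `L²(Es) ⊕ L²(E)`. -/
def modelOp : L2Sum E Es →L[ℂ] L2Sum E Es :=
  (WithLp.prodContinuousLinearEquiv 2 ℂ (L2 Es) (L2 E)).symm.toContinuousLinearMap ∘L
    (WithLp.fstL 2 ℂ (L2 Es) (L2 E) + boundaryMul Φ ∘L WithLp.sndL 2 ℂ (L2 Es) (L2 E)).prod
      ((boundaryMul Φ).adjoint ∘L WithLp.fstL 2 ℂ (L2 Es) (L2 E) +
        WithLp.sndL 2 ℂ (L2 Es) (L2 E))

/-- The de Branges–Rovnyak model space: the operator range of `[I, Φ; Φ*, I] ^ (1/2)`. -/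
abbrev Model : Type _ := OperatorRange (opSqrt (modelOp Φ))

/-- The pair `(f, g)` in `L²(Es) ⊕ L²(E)` that an element of the model space is. -/
abbrev toPair : Model Φ →L[ℂ] L2Sum E Es := OperatorRange.incl (opSqrt (modelOp Φ))

variable {Φ} in
theorem opSqrt_modelOp_mulZ (hΦ : IsSchur Φ) (j : Fin 2) (F : L2Sum E Es) :
    opSqrt (modelOp Φ) (mulZ E Es j F) = mulZ E Es j (opSqrt (modelOp Φ) F) := by
  refine opSqrt_commute _ _ (fun G => ?_) F
  apply (WithLp.prodContinuousLinearEquiv 2 ℂ (L2 Es) (L2 E)).injective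
  refine Prod.ext ?_ ?_
  · change mulMonomial Es _ G.fst + boundaryMul Φ (mulMonomial E _ G.snd) =
      mulMonomial Es _ (G.fst + boundaryMul Φ G.snd)
    rw [map_add, boundaryMul_mulMonomial hΦ]
  · change (boundaryMul Φ).adjoint (mulMonomial Es _ G.fst) + mulMonomial E _ G.snd =
      mulMonomial E _ ((boundaryMul Φ).adjoint G.fst + G.snd)
    rw [map_add, adjoint_boundaryMul_mulMonomial hΦ]

/-- Multiplication by `Z_j` on the model space. -/
def modelZ (j : Fin 2) : Model Φ →L[ℂ] Model Φ :=
  OperatorRange.mk (opSqrt (modelOp Φ)) ∘L mulZ E Es j ∘L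
    OperatorRange.preimage (opSqrt (modelOp Φ))

variable {Φ} in
theorem toPair_modelZ (hΦ : IsSchur Φ) (j : Fin 2) (F : Model Φ) :
    toPair Φ (modelZ Φ j F) = mulZ E Es j (toPair Φ F) := by
  simp only [modelZ, ContinuousLinearMap.comp_apply, toPair, OperatorRange.incl_mk,
    opSqrt_modelOp_mulZ hΦ]
  rfl

/-- The column `[Φ; I] : L²(E) → L²(Es) ⊕ L²(E)`. -/
def colPhi : L2 E →L[ℂ] L2Sum E Es :=
  (WithLp.prodContinuousLinearEquiv 2 ℂ (L2 Es) (L2 E)).symm.toContinuousLinearMap ∘L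
    (boundaryMul Φ).prod (ContinuousLinearMap.id ℂ (L2 E))

/-- The column `[I; Φ*] : L²(Es) → L²(Es) ⊕ L²(E)`. -/
def colPhiStar : L2 Es →L[ℂ] L2Sum E Es :=
  (WithLp.prodContinuousLinearEquiv 2 ℂ (L2 Es) (L2 E)).symm.toContinuousLinearMap ∘L
    (ContinuousLinearMap.id ℂ (L2 Es)).prod (boundaryMul Φ).adjoint

/-- A subspace of `L²(Es) ⊕ L²(E)`, regarded as a subspace of the model space. -/
abbrev inModel (S : Submodule ℂ (L2Sum E Es)) : Submodule ℂ (Model Φ) :=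
  S.comap (toPair Φ).toLinearMap

/-- The incoming subspace `W_* = [I; Φ*] (L² ⊖ H²(Es))`. -/
def incoming : Submodule ℂ (Model Φ) :=
  inModel Φ ((H2 Es)ᗮ.map (colPhiStar Φ).toLinearMap)

/-- The outgoing subspace `W = [Φ; I] H²(E)`. -/
def outgoing : Submodule ℂ (Model Φ) :=
  inModel Φ ((H2 E).map (colPhi Φ).toLinearMap)

/-- The scattering subspace `K_Φ`, the orthogonal complement of `W ⊕ W_*` in the model space. -/
abbrev scattering : Submodule ℂ (Model Φ) := (outgoing Φ ⊔ incoming Φ)ᗮ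

/-- The orthogonal projection `P_Φ` of the model space onto the scattering subspace. -/
abbrev scatteringProj : Model Φ →L[ℂ] scattering Φ := (scattering Φ).orthogonalProjectionOnto

/-- `S_j^max`: the elements of `K_Φ` all of whose multiples by powers of `Z_j` lie in `K_Φ`. -/
def Smax (j : Fin 2) : Submodule ℂ (scattering Φ) :=
  ⨅ k : ℕ, (scattering Φ).comap ((modelZ Φ j ^ k) ∘L (scattering Φ).subtypeL).toLinearMap

/-- `S_1^min = closure P_Φ [Φ; I] L²₊₋(E)` and `S_2^min = closure P_Φ [Φ; I] L²₋₊(E)`. -/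
def Smin (j : Fin 2) : Submodule ℂ (scattering Φ) :=
  ((inModel Φ ((mixed E j).map (colPhi Φ).toLinearMap)).map
    (scatteringProj Φ).toLinearMap).topologicalClosure

variable {Φ}

/-- `Z_j S` for a subspace `S` of `K_Φ`. -/
def shifted (j : Fin 2) (S : Submodule ℂ (scattering Φ)) : Submodule ℂ (scattering Φ) :=
  (S.map ((modelZ Φ j) ∘L (scattering Φ).subtypeL).toLinearMap).comap (scattering Φ).subtype

/-- The wandering subspace `S ⊖ Z_j S`. -/
def wandering (j : Fin 2) (S : Submodule ℂ (scattering Φ)) : Submodule ℂ (scattering Φ) :=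
  S ⊓ (shifted j S)ᗮ

variable (Φ)

/-- The residual subspace `R = S_1^max ⊖ S_1^min`. -/
def residual : Submodule ℂ (scattering Φ) := Smax Φ 0 ⊓ (Smin Φ 0)ᗮ

theorem isClosed_Smax (j : Fin 2) : IsClosed (Smax Φ j : Set (scattering Φ)) := by
  simp only [Smax, Submodule.coe_iInf]
  exact isClosed_iInter fun k => (Submodule.isClosed_orthogonal _).preimage
    ((modelZ Φ j ^ k) ∘L (scattering Φ).subtypeL).continuous

instance (j : Fin 2) : CompleteSpace (wandering j (Smax Φ j)) :=
  ((isClosed_Smax Φ j).inter (Submodule.isClosed_orthogonal _)).completeSpace_coe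

instance (j : Fin 2) : CompleteSpace (wandering j (Smin Φ j)) :=
  ((Submodule.isClosed_topologicalClosure _).inter
    (Submodule.isClosed_orthogonal _)).completeSpace_coe

instance : CompleteSpace (residual Φ) :=
  ((isClosed_Smax Φ 0).inter (Submodule.isClosed_orthogonal _)).completeSpace_coe

/-! ### The de Branges–Rovnyak space and the canonical kernels -/

/-- The operator `D = (I - Φ P_{H²(E)} Φ*) ^ (1/2)` on `H²(Es)`. -/
def defectOp : H2 Es →L[ℂ] H2 Es :=
  opSqrt (1 - (H2 Es).orthogonalProjectionOnto ∘L
    (boundaryMul Φ ∘L (H2 E).starProjection ∘L (boundaryMul Φ).adjoint) ∘L (H2 Es).subtypeL)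

/-- The two-variable de Branges–Rovnyak space `H_Φ`, as the space of functions on the bidisk that
is the operator range of `D`. -/
abbrev DBRSpace : Type _ := OperatorRange (toBidisk Es ∘L (H2 Es).subtypeL ∘L defectOp Φ)

variable {Φ}

/-- `V` is the canonical isometry of `H_Φ` into `K_Φ`: `V f = (f, g)` for some `g`, and
`V* (f, g) = f` for all `(f, g)` in `K_Φ`. -/
def IsCanonicalIsometry (V : DBRSpace Φ →ₗᵢ[ℂ] scattering Φ) : Prop :=
  (∀ f : DBRSpace Φ, toBidisk Es (toPair Φ (V f)).fst = f) ∧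
    ∀ F : scattering Φ, V.toContinuousLinearMap.adjoint F = toBidisk Es (toPair Φ F).fst

/-- The restriction of `V*` to a subspace `N`, as an operator into the functions on the bidisk. -/
def restrictedAdjoint (V : DBRSpace Φ →ₗᵢ[ℂ] scattering Φ) (N : Submodule ℂ (scattering Φ)) :
    N →L[ℂ] (Bidisk → Es) :=
  (RKHS.coeCLM ℂ : DBRSpace Φ →L[ℂ] (Bidisk → Es)) ∘L
    V.toContinuousLinearMap.adjoint ∘L N.subtypeL

/-- The reproducing kernel of the operator range of `V*` restricted to a closed subspace `N`. -/
def rangeKernel (V : DBRSpace Φ →ₗᵢ[ℂ] scattering Φ) (N : Submodule ℂ (scattering Φ))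
    [CompleteSpace N] : Bidisk → Bidisk → (Es →L[ℂ] Es) :=
  fun z w => RKHS.kernel (OperatorRange (H := N) (Y := Bidisk → Es) (restrictedAdjoint V N)) z w

/-- The canonical kernel `K_j^max`, for `V` the canonical isometry. -/
def Kmax (V : DBRSpace Φ →ₗᵢ[ℂ] scattering Φ) (j : Fin 2) : Bidisk → Bidisk → (Es →L[ℂ] Es) :=
  rangeKernel V (wandering j (Smax Φ j))

/-- The canonical kernel `K_j^min`, for `V` the canonical isometry. -/
def Kmin (V : DBRSpace Φ →ₗᵢ[ℂ] scattering Φ) (j : Fin 2) : Bidisk → Bidisk → (Es →L[ℂ] Es) :=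
  rangeKernel V (wandering j (Smin Φ j))

/-- The kernel `G`, the reproducing kernel of the operator range of `V*` restricted to `R`. -/
def residualKernel (V : DBRSpace Φ →ₗᵢ[ℂ] scattering Φ) : Bidisk → Bidisk → (Es →L[ℂ] Es) :=
  rangeKernel V (residual Φ)

end Model

end AglerDecomp

end

/-!
Every element of the model space `𝓗` is a pair `(F₁, F₂)` in `L²(Es) ⊕ L²(E)`. Since `𝓗` is the
operator range of the square root of `A = [I, Φ; Φ*, I]`, the vector `A x`, seen in `𝓗`,
represents the functional `F ↦ ⟪x, F⟫`. In particular `[Φ; I] g` represents `F ↦ ⟪g, F₂⟫` and `[I;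
Φ*] f` represents `F ↦ ⟪f, F₁⟫` (`inner_outElt`, `inner_inElt`). Hence `K_Φ` consists of the `F`
with `F₁` in `H²(Es)` and `F₂` orthogonal to `H²(E)` (`mem_scattering`), and all questions about
the subspaces of `K_Φ` become questions about Fourier supports: `F` is in `S_i^max` exactly when
`F₂` is supported where the other index is negative (`mem_Smax`). Within `K_Φ` the orthogonal
complement of `S_j^min` is therefore `S_i^max`, for `i ≠ j` (`Smin_orthogonal`). As multiplication
by `Φ` preserves the half-planes `n_i ≥ 0` and its adjoint the half-planes `n_i < 0`, moreover
`S_j^min ⊆ S_j^max`, and `Z_j` maps `S_j^min` into itself (`Smin_le_Smax`,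
`scatteringProj_modelZ_mem_Smin`).

Let `ℓ_z F = F₁(z)` on `K_Φ`. The projection to `K_Φ` of the representative of `ℓ_w` is explicit,
and `ℓ_z ℓ_w*` turns out to be the de Branges–Rovnyak kernel (`scatteringEval_adjoint`), which is
also the kernel of `H_Φ` (`kernel_DBRSpace`). The kernel functions of `H_Φ` and the vectors `ℓ_w*
e` thus have the same Gram matrix, and sending the former to the latter defines the isometry `V`;
its adjoint is `F ↦ F₁` (`exists_isCanonicalIsometry`).

The kernel of the operator range of `V*` restricted to a closed subspace `N` is `ℓ_z P_N ℓ_w*`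
(`rangeKernel_eq`). It is additive over orthogonal sums, and if the isometry `Z_j` maps `S ⊆
S_j^max` into itself, the kernel of `Z_j S` is `z_j w̄_j` times that of `S`. So the kernel of `S ⊖
Z_j S` is `1 - z_j w̄_j` times that of `S` (`compressedKernel_wandering`). The identities for the
kernels are then those for projections given by `K_Φ = S_i^max ⊕ S_j^min` and `S_1^max = S_1^min ⊕
R`.

The boundary values of `Φ` are constructed as strong limits of the dilates `ζ ↦ Φ(r ζ)`. For a
constant `e`, the Fourier coefficients of the dilates of `Φ e` are `r^|n| a_n`, with `a_n` the
Taylor coefficients of `Φ e`. By Parseval's identity and `‖Φ‖ ≤ 1` the `a_n` are square summable,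
so the dilates converge in `L²` (`exists_tendsto_dilateMul_const`); the general case follows by
density.
-/

namespace AglerDecomp

/-! ### Fourier analysis on `L²(E)` -/

section Fourier

variable {E : Type*} [NormedAddCommGroup E] [InnerProductSpace ℂ E] [CompleteSpace E]

theorem mulMonomial_mulMonomial (m n : Fin 2 → ℤ) (f : L2 E) :
    mulMonomial E m (mulMonomial E n f) = mulMonomial E (m + n) f := by
  refine Lp.ext ?_
  filter_upwards [coeFn_mulMonomial E m (mulMonomial E n f), coeFn_mulMonomial E n f,
    coeFn_mulMonomial E (m + n) f] with ζ h1 h2 h3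
  rw [h1, h2, h3, UnitAddTorus.mFourier_add, mul_smul]

theorem mulMonomial_zero (f : L2 E) : mulMonomial E 0 f = f := by
  refine Lp.ext ?_
  filter_upwards [coeFn_mulMonomial E 0 f] with ζ h1
  rw [h1, UnitAddTorus.mFourier_zero]
  simp

theorem inner_mulMonomial_mulMonomial (n : Fin 2 → ℤ) (f g : L2 E) :
    inner ℂ (mulMonomial E n f) (mulMonomial E n g) = inner ℂ f g := by
  rw [inner_mulMonomial, mulMonomial_mulMonomial, neg_add_cancel, mulMonomial_zero]

theorem norm_mulMonomial (n : Fin 2 → ℤ) (f : L2 E) : ‖mulMonomial E n f‖ = ‖f‖ := by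
  rw [@norm_eq_sqrt_re_inner ℂ, inner_mulMonomial_mulMonomial, ← norm_eq_sqrt_re_inner]

theorem integral_mFourier (n : Fin 2 → ℤ) :
    ∫ ζ, UnitAddTorus.mFourier n ζ ∂torusMeasure = if n = 0 then 1 else 0 := by
  have h := orthonormal_iff_ite.1 (UnitAddTorus.orthonormal_mFourier (d := Fin 2)) 0 n
  rw [ContinuousMap.inner_toLp] at h
  simp only [UnitAddTorus.mFourier_zero, ContinuousMap.one_apply, map_one, mul_one] at h
  simp only [eq_comm (a := n)]
  exact h

theorem coeff_mulMonomial (m n : Fin 2 → ℤ) (f : L2 E) :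
    coeff E m (mulMonomial E n f) = coeff E (m - n) f := by
  rw [coeff_apply, coeff_apply]
  refine integral_congr_ae ?_
  have h : ∀ᵐ ζ ∂torusMeasure, mulMonomial E n f ζ = UnitAddTorus.mFourier n ζ • f ζ :=
    coeFn_mulMonomial E n f
  filter_upwards [h] with ζ h1
  rw [h1, smul_smul, ← UnitAddTorus.mFourier_add]
  congr 3
  abel

variable (E) in
/-- The isometric embedding `e ↦ ζⁿ e` of `E` into `L²(E)`. -/
noncomputable def monomial (n : Fin 2 → ℤ) : E →ₗᵢ[ℂ] L2 E where
  toLinearMap := (mulMonomial E n ∘L Lp.constL 2 torusMeasure ℂ).toLinearMap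
  norm_map' e := by
    change ‖mulMonomial E n (Lp.constL 2 torusMeasure ℂ e)‖ = ‖e‖
    rw [norm_mulMonomial]
    change ‖Lp.const 2 torusMeasure e‖ = ‖e‖
    refine (Lp.norm_const' 2 torusMeasure e (by norm_num) (by norm_num)).trans ?_
    simp

theorem monomial_apply (n : Fin 2 → ℤ) (e : E) :
    monomial E n e = mulMonomial E n (Lp.const 2 torusMeasure e) := rfl

theorem coeFn_monomial (n : Fin 2 → ℤ) (e : E) :
    monomial E n e =ᵐ[torusMeasure] fun ζ => UnitAddTorus.mFourier n ζ • e := by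
  filter_upwards [coeFn_mulMonomial E n (Lp.const 2 torusMeasure e),
    Lp.coeFn_const 2 torusMeasure e] with ζ h1 h2
  rw [monomial_apply, h1, h2]
  rfl

theorem monomial_eq_mulMonomial (n : Fin 2 → ℤ) (e : E) :
    monomial E n e = mulMonomial E n (monomial E 0 e) := by
  rw [monomial_apply, monomial_apply, mulMonomial_zero]

theorem coeff_monomial (m n : Fin 2 → ℤ) (e : E) :
    coeff E m (monomial E n e) = if m = n then e else 0 := by
  rw [monomial_apply, coeff_mulMonomial, coeff_apply]
  have h : UnitAddTorus.mFourierCoeff (Lp.const 2 torusMeasure e) (m - n) =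
      ∫ ζ, UnitAddTorus.mFourier (-(m - n)) ζ • e ∂torusMeasure := by
    refine integral_congr_ae ?_
    have h2 : ∀ᵐ ζ ∂torusMeasure, Lp.const 2 torusMeasure e ζ = e :=
      Lp.coeFn_const 2 torusMeasure e
    filter_upwards [h2] with ζ h2
    rw [h2]
  rw [h, integral_smul_const, integral_mFourier]
  simp only [neg_eq_zero, sub_eq_zero]
  split_ifs <;> simp

theorem inner_monomial_left (n : Fin 2 → ℤ) (e : E) (f : L2 E) :
    inner ℂ (monomial E n e) f = inner ℂ e (coeff E n f) := by
  have hi : Integrable (fun ζ => UnitAddTorus.mFourier (-n) ζ • f ζ) torusMeasure := by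
    have h : Integrable (mulMonomial E (-n) f) torusMeasure :=
      (Lp.memLp (mulMonomial E (-n) f)).integrable (by norm_num)
    exact h.congr (coeFn_mulMonomial E (-n) f)
  have h2 : coeff E n f = ∫ ζ, UnitAddTorus.mFourier (-n) ζ • f ζ ∂torusMeasure := coeff_apply E n f
  rw [h2, ← integral_inner hi, L2.inner_def]
  refine integral_congr_ae ?_
  filter_upwards [coeFn_monomial n e] with ζ h1
  rw [h1, inner_smul_left, inner_smul_right, UnitAddTorus.mFourier_neg]

theorem norm_coeff_le (n : Fin 2 → ℤ) (f : L2 E) : ‖coeff E n f‖ ≤ ‖f‖ := by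
  have h := norm_inner_le_norm (𝕜 := ℂ) (monomial E n (coeff E n f)) f
  rw [inner_monomial_left, LinearIsometry.norm_map, inner_self_eq_norm_sq_to_K] at h
  simp only [norm_pow, RCLike.norm_ofReal, abs_norm] at h
  by_contra! hc
  nlinarith [norm_nonneg (coeff E n f), norm_nonneg f]

/-- Uniqueness of Fourier coefficients, from the scalar case by pairing with vectors of `E`. -/
theorem eq_zero_of_coeff [TopologicalSpace.SeparableSpace E] {f : L2 E}
    (h : ∀ n, coeff E n f = 0) : f = 0 := by
  have := UniformSpace.secondCountable_of_separable E
  have key : ∀ c : E, (fun ζ => inner ℂ c (f ζ)) =ᵐ[torusMeasure] 0 := by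
    intro c
    have hg := ContinuousLinearMap.coeFn_compLp (innerSL ℂ c) f
    set g : Lp ℂ 2 torusMeasure := (innerSL ℂ c).compLp f with hgdef
    have h0 : g = 0 := by
      refine (LinearIsometryEquiv.map_eq_zero_iff
        (UnitAddTorus.mFourierBasis (d := Fin 2)).repr).1 ?_
      ext n
      rw [UnitAddTorus.mFourierBasis_repr]
      have h1 : UnitAddTorus.mFourierCoeff g n =
          ∫ ζ, UnitAddTorus.mFourier (-n) ζ • inner ℂ c (f ζ) ∂torusMeasure := by
        refine integral_congr_ae ?_
        have hg' : ∀ᵐ ζ ∂torusMeasure, g ζ = inner ℂ c (f ζ) := hg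
        filter_upwards [hg'] with ζ h1
        rw [h1]
      have h2 : inner ℂ c (coeff E n f) =
          ∫ ζ, UnitAddTorus.mFourier (-n) ζ • inner ℂ c (f ζ) ∂torusMeasure := by
        rw [← inner_monomial_left, L2.inner_def]
        refine integral_congr_ae ?_
        filter_upwards [coeFn_monomial n c] with ζ h1
        rw [h1, inner_smul_left, UnitAddTorus.mFourier_neg, smul_eq_mul]
      rw [h1, ← h2, h n, inner_zero_right]
      rfl
    rw [h0] at hg
    filter_upwards [hg, Lp.coeFn_zero ℂ 2 torusMeasure] with ζ h1 h2
    rw [h2] at h1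
    exact h1.symm
  refine Lp.ext ?_
  filter_upwards [ae_eq_zero_of_forall_inner (𝕜 := ℂ) key, Lp.coeFn_zero E 2 torusMeasure]
    with ζ h1 h2
  rw [h1, h2]

theorem orthogonalFamily_monomial : OrthogonalFamily ℂ (fun _ : Fin 2 → ℤ => E) (monomial E) := by
  intro m n hmn e e'
  rw [inner_monomial_left, coeff_monomial, if_neg hmn, inner_zero_right]

variable (E) in
theorem isHilbertSum_monomial [TopologicalSpace.SeparableSpace E] :
    IsHilbertSum ℂ (fun _ : Fin 2 → ℤ => E) (monomial E) := by
  refine IsHilbertSum.mk orthogonalFamily_monomial (le_of_eq ?_)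
  symm
  rw [Submodule.topologicalClosure_eq_top_iff, Submodule.eq_bot_iff]
  intro f hf
  refine eq_zero_of_coeff fun n => ?_
  refine ext_inner_left ℂ fun e => ?_
  rw [inner_zero_right, ← inner_monomial_left]
  exact hf _ (Submodule.mem_iSup_of_mem n ⟨e, rfl⟩)

theorem linearIsometryEquiv_apply_coeff [TopologicalSpace.SeparableSpace E] (f : L2 E)
    (n : Fin 2 → ℤ) : (isHilbertSum_monomial E).linearIsometryEquiv f n = coeff E n f := by
  have h := ((isHilbertSum_monomial E).hasSum_linearIsometryEquiv_symm
    ((isHilbertSum_monomial E).linearIsometryEquiv f)).mapL (coeff E n)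
  rw [LinearIsometryEquiv.symm_apply_apply] at h
  refine HasSum.unique ?_ h
  refine (hasSum_ite_eq n ((isHilbertSum_monomial E).linearIsometryEquiv f n)).congr_fun
    fun m => ?_
  rw [coeff_monomial]
  by_cases hmn : m = n
  · subst hmn; simp
  · rw [if_neg hmn, if_neg (Ne.symm hmn)]

theorem hasSum_monomial_coeff [TopologicalSpace.SeparableSpace E] (f : L2 E) :
    HasSum (fun n => monomial E n (coeff E n f)) f := by
  have h := (isHilbertSum_monomial E).hasSum_linearIsometryEquiv_symm
    ((isHilbertSum_monomial E).linearIsometryEquiv f)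
  simpa only [linearIsometryEquiv_apply_coeff, LinearIsometryEquiv.symm_apply_apply] using h

theorem hasSum_inner_coeff [TopologicalSpace.SeparableSpace E] (f g : L2 E) :
    HasSum (fun n => inner ℂ (coeff E n f) (coeff E n g)) (inner ℂ f g) := by
  refine ((hasSum_monomial_coeff g).mapL (innerSL ℂ f)).congr_fun fun n => ?_
  rw [innerSL_apply_apply, ← inner_conj_symm, ← inner_monomial_left, inner_conj_symm]

theorem hasSum_norm_sq_coeff [TopologicalSpace.SeparableSpace E] (f : L2 E) :
    HasSum (fun n => ‖coeff E n f‖ ^ 2) (‖f‖ ^ 2) := by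
  have h := (hasSum_inner_coeff f f).mapL Complex.reCLM
  simp only [Complex.reCLM_apply] at h
  simpa only [← RCLike.re_eq_complex_re, inner_self_eq_norm_sq] using h

/-- The Riesz–Fischer theorem for `L²(E)`. -/
theorem exists_coeff_eq [TopologicalSpace.SeparableSpace E] {a : (Fin 2 → ℤ) → E}
    (ha : Summable fun n => ‖a n‖ ^ 2) : ∃ f : L2 E, ∀ n, coeff E n f = a n := by
  have hm : Memℓp a 2 := by
    refine memℓp_gen ?_
    simpa using ha
  refine ⟨(isHilbertSum_monomial E).linearIsometryEquiv.symm ⟨a, hm⟩, fun n => ?_⟩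
  rw [← linearIsometryEquiv_apply_coeff, LinearIsometryEquiv.apply_symm_apply]

theorem mem_supportedIn {N : Set (Fin 2 → ℤ)} {f : L2 E} :
    f ∈ supportedIn E N ↔ ∀ n, n ∉ N → coeff E n f = 0 := by
  simp [supportedIn, Submodule.mem_iInf]

theorem monomial_mem_supportedIn {N : Set (Fin 2 → ℤ)} {n : Fin 2 → ℤ} (hn : n ∈ N) (e : E) :
    monomial E n e ∈ supportedIn E N :=
  mem_supportedIn.2 fun m hm => by
    rw [coeff_monomial, if_neg]
    rintro rfl
    exact hm hn

theorem supportedIn_mono {N N' : Set (Fin 2 → ℤ)} (h : N ⊆ N') :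
    supportedIn E N ≤ supportedIn E N' := fun _ hf =>
  mem_supportedIn.2 fun n hn => mem_supportedIn.1 hf n fun hn' => hn (h hn')

theorem supportedIn_orthogonal [TopologicalSpace.SeparableSpace E] (N : Set (Fin 2 → ℤ)) :
    (supportedIn E N)ᗮ = supportedIn E Nᶜ := by
  ext f
  rw [Submodule.mem_orthogonal, mem_supportedIn]
  constructor
  · intro h n hn
    refine ext_inner_left ℂ fun e => ?_
    rw [inner_zero_right, ← inner_monomial_left]
    exact h _ (monomial_mem_supportedIn (not_not.1 hn) e)
  · intro h g hg
    have h2 := hasSum_inner_coeff g f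
    have h3 : (fun n => inner ℂ (coeff E n g) (coeff E n f)) = fun _ => (0 : ℂ) := by
      funext n
      by_cases hn : n ∈ N
      · rw [h n (not_not.2 hn), inner_zero_right]
      · rw [mem_supportedIn.1 hg n hn, inner_zero_left]
    rw [h3] at h2
    exact h2.unique hasSum_zero

theorem starProjection_supportedIn_coeff [TopologicalSpace.SeparableSpace E]
    (N : Set (Fin 2 → ℤ)) (f : L2 E) {n : Fin 2 → ℤ} (hn : n ∈ N) :
    coeff E n ((supportedIn E N).starProjection f) = coeff E n f := by
  have h : f - (supportedIn E N).starProjection f ∈ (supportedIn E N)ᗮ :=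
    Submodule.sub_starProjection_mem_orthogonal f
  rw [supportedIn_orthogonal, mem_supportedIn] at h
  have h2 := h n (not_not.2 hn)
  rw [map_sub, sub_eq_zero] at h2
  exact h2.symm

/-! ### Evaluation at points of the bidisk -/

theorem summable_prod_pow {x : Fin 2 → ℂ} (hx : ∀ j, ‖x j‖ < 1) :
    Summable fun n : Fin 2 → ℕ => ‖∏ j, x j ^ n j‖ := by
  have h : Summable fun p : ℕ × ℕ => ‖x 0 ^ p.1 * x 1 ^ p.2‖ := by
    refine (Summable.mul_of_nonneg (summable_geometric_of_lt_one (norm_nonneg _) (hx 0))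
      (summable_geometric_of_lt_one (norm_nonneg _) (hx 1)) (fun _ => by positivity)
      (fun _ => by positivity)).congr fun p => by simp
  have h2 := (piFinTwoEquiv fun _ => ℕ).summable_iff.2 h
  refine h2.congr fun n => ?_
  simp [Fin.prod_univ_two]

theorem hasSum_prod_pow {x : Fin 2 → ℂ} (hx : ∀ j, ‖x j‖ < 1) :
    HasSum (fun n : Fin 2 → ℕ => ∏ j, x j ^ n j) ((1 - x 0) * (1 - x 1))⁻¹ := by
  have h0 := hasSum_geometric_of_norm_lt_one (hx 0)
  have h1 := hasSum_geometric_of_norm_lt_one (hx 1)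
  have hs : Summable fun p : ℕ × ℕ => x 0 ^ p.1 * x 1 ^ p.2 :=
    summable_mul_of_summable_norm (f := fun n : ℕ => x 0 ^ n) (g := fun n : ℕ => x 1 ^ n)
      (by simpa using summable_geometric_of_lt_one (norm_nonneg _) (hx 0))
      (by simpa using summable_geometric_of_lt_one (norm_nonneg _) (hx 1))
  have h := h0.mul h1 hs
  rw [← mul_inv] at h
  refine ((piFinTwoEquiv fun _ => ℕ).hasSum_iff.2 h).congr_fun fun n => ?_
  simp [Fin.prod_univ_two]

variable (E) in
/-- Evaluation at the point `z` of the bidisk of the analytic part of an element of `L²(E)`. -/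
noncomputable def evalAt (z : Bidisk) : L2 E →L[ℂ] E :=
  ContinuousLinearMap.proj z ∘L toBidisk E

theorem hasSum_tsum_smul_apply {ι F G : Type*} [NormedAddCommGroup F] [NormedSpace ℂ F]
    [NormedAddCommGroup G] [NormedSpace ℂ G] [CompleteSpace G] {c : ι → ℂ}
    (hc : Summable fun i => ‖c i‖) {A : ι → F →L[ℂ] G} (hA : ∀ i f, ‖A i f‖ ≤ ‖f‖) (f : F) :
    HasSum (fun i => c i • A i f) ((∑' i, c i • A i) f) := by
  have hs : Summable fun i => c i • A i := by
    refine Summable.of_norm_bounded hc fun i => ?_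
    rw [norm_smul]
    refine mul_le_of_le_one_right (norm_nonneg _) ?_
    exact ContinuousLinearMap.opNorm_le_bound _ zero_le_one fun f => by rw [one_mul]; exact hA i f
  exact hs.hasSum.mapL (ContinuousLinearMap.apply ℂ G f)

theorem hasSum_evalAt (z : Bidisk) (f : L2 E) :
    HasSum (fun n : Fin 2 → ℕ => (∏ j, z.1 j ^ n j) • coeff E (fun j => (n j : ℤ)) f)
      (evalAt E z f) :=
  hasSum_tsum_smul_apply (c := fun n : Fin 2 → ℕ => ∏ j, z.1 j ^ n j)
    (A := fun n : Fin 2 → ℕ => coeff E fun j => (n j : ℤ)) (summable_prod_pow (x := z.1) z.2)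
    (fun _ f => norm_coeff_le _ f) f

theorem evalAt_congr {f g : L2 E} (z : Bidisk)
    (h : ∀ n : Fin 2 → ℤ, (∀ i, 0 ≤ n i) → coeff E n f = coeff E n g) :
    evalAt E z f = evalAt E z g := by
  refine (hasSum_evalAt z f).unique ((hasSum_evalAt z g).congr_fun fun n => ?_)
  rw [h _ fun i => Int.natCast_nonneg _]

theorem evalAt_starProjection [TopologicalSpace.SeparableSpace E] (z : Bidisk) (f : L2 E) :
    evalAt E z ((H2 E).starProjection f) = evalAt E z f :=
  evalAt_congr z fun _ hn => starProjection_supportedIn_coeff _ f hn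

theorem evalAt_eq_zero {f : L2 E} (z : Bidisk)
    (h : ∀ n : Fin 2 → ℤ, (∀ i, 0 ≤ n i) → coeff E n f = 0) : evalAt E z f = 0 := by
  rw [← map_zero (evalAt E z)]
  exact evalAt_congr z fun n hn => by rw [h n hn, map_zero]

theorem evalAt_mulMonomial (z : Bidisk) (m : Fin 2 → ℕ) {f : L2 E} (hf : f ∈ H2 E) :
    evalAt E z (mulMonomial E (fun j => (m j : ℤ)) f) = (∏ j, z.1 j ^ m j) • evalAt E z f := by
  have h1 := (hasSum_evalAt z f).const_smul (∏ j, z.1 j ^ m j)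
  refine HasSum.unique (hasSum_evalAt z _) ?_
  have hinj : Function.Injective fun n : Fin 2 → ℕ => m + n := add_right_injective m
  refine (hinj.hasSum_iff fun n hn => ?_).1 (h1.congr_fun fun n => ?_)
  · rw [coeff_mulMonomial, mem_supportedIn.1 hf, smul_zero]
    intro hc
    refine hn ⟨n - m, ?_⟩
    funext i
    have := hc i
    simp only [Pi.sub_apply] at this
    simp only [Pi.add_apply, Pi.sub_apply]
    lia
  · simp only [Function.comp, coeff_mulMonomial, smul_smul]
    congr 1
    · rw [← Finset.prod_mul_distrib]
      exact Finset.prod_congr rfl fun j _ => by rw [Pi.add_apply, pow_add]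
    · congr 2
      funext i
      simp

theorem evalAt_monomial (z : Bidisk) (m : Fin 2 → ℕ) (e : E) :
    evalAt E z (monomial E (fun j => (m j : ℤ)) e) = (∏ j, z.1 j ^ m j) • e := by
  refine (hasSum_evalAt z _).unique ((hasSum_ite_eq m _).congr_fun fun n => ?_)
  rw [coeff_monomial]
  by_cases h : n = m
  · subst h; simp
  · rw [if_neg h, if_neg, smul_zero]
    intro hc
    refine h (funext fun i => ?_)
    exact_mod_cast congrFun hc i

theorem coeff_adjoint_evalAt (w : Bidisk) (e : E) (n : Fin 2 → ℕ) :
    coeff E (fun j => (n j : ℤ)) ((evalAt E w).adjoint e) = (∏ j, conj (w.1 j) ^ n j) • e := by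
  refine ext_inner_left ℂ fun c => ?_
  rw [← inner_monomial_left, ContinuousLinearMap.adjoint_inner_right, evalAt_monomial,
    inner_smul_left, inner_smul_right]
  simp

theorem adjoint_evalAt_mem_H2 (w : Bidisk) (e : E) : (evalAt E w).adjoint e ∈ H2 E := by
  refine mem_supportedIn.2 fun n hn => ?_
  refine ext_inner_left ℂ fun c => ?_
  rw [← inner_monomial_left, ContinuousLinearMap.adjoint_inner_right, evalAt_eq_zero,
    inner_zero_left, inner_zero_right]
  intro m hm
  rw [coeff_monomial, if_neg]
  rintro rfl
  exact hn hm

/-- The Szegő kernel of the bidisk is the reproducing kernel of `H²(E)`. -/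
theorem evalAt_adjoint_evalAt (z w : Bidisk) (e : E) :
    evalAt E z ((evalAt E w).adjoint e) =
      ((1 - z.1 0 * conj (w.1 0)) * (1 - z.1 1 * conj (w.1 1)))⁻¹ • e := by
  have hx : ∀ j, ‖z.1 j * conj (w.1 j)‖ < 1 := fun j => by
    rw [norm_mul, RCLike.norm_conj]
    exact mul_lt_one_of_nonneg_of_lt_one_left (norm_nonneg _) (z.2 j) (w.2 j).le
  refine (hasSum_evalAt z _).unique
    (((hasSum_prod_pow (x := fun j => z.1 j * conj (w.1 j)) hx).smul_const e).congr_fun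
      fun n => ?_)
  rw [coeff_adjoint_evalAt, smul_smul, ← Finset.prod_mul_distrib]
  simp only [mul_pow]

end Fourier

/-! ### Power series on the bidisk -/

section PowerSeries

variable {F : Type*} [NormedAddCommGroup F] [NormedSpace ℂ F] [CompleteSpace F]

theorem integral_fourier (n : ℤ) :
    ∫ t : AddCircle (1 : ℝ), fourier n t ∂AddCircle.haarAddCircle = if n = 0 then 1 else 0 := by
  have h := orthonormal_iff_ite.1 (orthonormal_fourier (T := 1)) 0 n
  rw [ContinuousMap.inner_toLp] at h
  simp only [eq_comm (a := n)]
  simpa using h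

theorem norm_mul_toCircle {r : ℝ} (h0 : 0 ≤ r) (t : AddCircle (1 : ℝ)) :
    ‖(r : ℂ) * (AddCircle.toCircle t : ℂ)‖ = r := by
  rw [norm_mul, Circle.norm_coe, mul_one, Complex.norm_real, Real.norm_of_nonneg h0]

/-- The Fourier coefficients of a holomorphic function on the circle of radius `r` are `rⁿ bₙ`, with
`bₙ` independent of `r` and zero for negative `n`. -/
theorem exists_fourierCoeff_dilate {g : ℂ → F} (hg : DifferentiableOn ℂ g (Metric.ball 0 1)) :
    ∃ b : ℤ → F, (∀ n < 0, b n = 0) ∧ ∀ r : ℝ, 0 ≤ r → r < 1 → ∀ n : ℤ,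
      ∫ t, fourier (-n) t • g ((r : ℂ) * (AddCircle.toCircle t : ℂ))
        ∂(AddCircle.haarAddCircle : Measure (AddCircle (1 : ℝ))) = (r : ℂ) ^ n.toNat • b n := by
  obtain ⟨d, hsum⟩ : ∃ d : ℕ → F, ∀ z : ℂ, ‖z‖ < 1 → HasSum (fun k => z ^ k • d k) (g z) := by
    refine ⟨fun k => ((k.factorial : ℂ)⁻¹) • iteratedDeriv k g 0, fun z hz => ?_⟩
    refine (Complex.hasSum_taylorSeries_on_ball hg (by simpa using hz)).congr_fun fun k => ?_
    rw [sub_zero, smul_comm]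
  have habs : ∀ r : ℝ, 0 ≤ r → r < 1 → Summable fun k => r ^ k * ‖d k‖ := by
    intro r h0 h1
    obtain ⟨ρ, hρ, hρ1⟩ := exists_between h1
    have hρ0 : 0 < ρ := h0.trans_lt hρ
    have ht := (hsum (ρ : ℂ) (by simpa [abs_of_pos hρ0] using hρ1)).summable.tendsto_atTop_zero
    obtain ⟨C, hC⟩ := ht.norm.bddAbove_range
    refine Summable.of_nonneg_of_le (fun k => by positivity) (fun k => ?_)
      ((summable_geometric_of_lt_one (by positivity) ((div_lt_one hρ0).2 hρ)).mul_left C)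
    have h2 : ρ ^ k * ‖d k‖ ≤ C := by
      have := hC ⟨k, rfl⟩
      simpa [norm_smul, abs_of_pos hρ0] using this
    rw [div_pow, ← mul_div_assoc, le_div_iff₀ (by positivity)]
    calc r ^ k * ‖d k‖ * ρ ^ k = r ^ k * (ρ ^ k * ‖d k‖) := by ring
      _ ≤ r ^ k * C := by gcongr
      _ = C * r ^ k := mul_comm _ _
  -- The power series converges absolutely on the circle and can be integrated term by term.
  refine ⟨fun n => if n < 0 then 0 else d n.toNat, fun n hn => if_pos hn, fun r h0 h1 n => ?_⟩
  set G : ℕ → AddCircle (1 : ℝ) → F := fun k t =>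
    fourier ((k : ℤ) - n) t • ((r : ℂ) ^ k • d k) with hG
  have hGn : ∀ k t, ‖G k t‖ = r ^ k * ‖d k‖ := by
    intro k t
    rw [hG, norm_smul, norm_smul, norm_pow, Complex.norm_real, Real.norm_of_nonneg h0,
      fourier_apply, Circle.norm_coe, one_mul]
  have hGc : ∀ k, Continuous (G k) := fun k => by
    simp only [hG]
    fun_prop
  have hGi : ∀ k, Integrable (G k) (AddCircle.haarAddCircle : Measure (AddCircle (1 : ℝ))) :=
    fun k => (hGc k).integrable_of_hasCompactSupport (HasCompactSupport.of_compactSpace _)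
  have hHS := hasSum_integral_of_summable_integral_norm hGi (by
    simp only [hGn, integral_const, probReal_univ, one_smul]
    exact habs r h0 h1)
  have hpt : ∀ t, ∑' k, G k t =
      fourier (-n) t • g ((r : ℂ) * (AddCircle.toCircle t : ℂ)) := by
    intro t
    have h3 := (hsum ((r : ℂ) * (AddCircle.toCircle t : ℂ))
      (by rw [norm_mul_toCircle h0]; exact h1)).const_smul (fourier (-n) t)
    refine (h3.congr_fun fun k => ?_).tsum_eq
    have h4 : fourier ((k : ℤ) - n) t = fourier (-n) t * (AddCircle.toCircle t : ℂ) ^ k := by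
      rw [sub_eq_neg_add, fourier_add]
      congr 1
      rw [fourier_apply, AddCircle.toCircle_zsmul, Circle.coe_zpow, zpow_natCast]
    simp only [hG]
    rw [h4, mul_pow, smul_smul, smul_smul]
    congr 1
    ring
  simp only [hpt] at hHS
  have hint : ∀ k, ∫ t, G k t ∂(AddCircle.haarAddCircle : Measure (AddCircle (1 : ℝ))) =
      if (k : ℤ) = n then (r : ℂ) ^ k • d k else 0 := by
    intro k
    simp only [hG]
    rw [integral_smul_const, integral_fourier]
    simp only [sub_eq_zero]
    split_ifs <;> simp
  simp only [hint] at hHS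
  beta_reduce
  rcases lt_or_ge n 0 with hn | hn
  · rw [if_pos hn, smul_zero]
    refine hHS.unique (hasSum_zero.congr_fun fun k => ?_)
    rw [if_neg (by lia)]
  · rw [if_neg (by lia)]
    lift n to ℕ using hn
    simp only [Nat.cast_inj, Int.toNat_natCast] at hHS ⊢
    refine hHS.unique ((hasSum_ite_eq n ((r : ℂ) ^ n • d n)).congr_fun fun k => ?_)
    by_cases hk : k = n
    · subst hk; simp
    · rw [if_neg hk, if_neg hk]

/-- The point of the polytorus with radii `r` over the point `ζ` of the torus. -/
noncomputable def polyPoint (r : Fin 2 → ℝ) (ζ : Torus) : Fin 2 → ℂ :=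
  fun j => (r j : ℂ) * (AddCircle.toCircle (ζ j) : ℂ)

theorem norm_polyPoint_lt {r : Fin 2 → ℝ} (h0 : ∀ j, 0 ≤ r j) (h1 : ∀ j, r j < 1) (ζ : Torus)
    (j : Fin 2) : ‖polyPoint r ζ j‖ < 1 := by
  rw [polyPoint, norm_mul_toCircle (h0 j)]
  exact h1 j

theorem continuous_polyPoint (r : Fin 2 → ℝ) : Continuous (polyPoint r) := by
  unfold polyPoint
  fun_prop

theorem continuous_comp_polyPoint {u : (Fin 2 → ℂ) → F}
    (hu : DifferentiableOn ℂ u {z | ∀ j, ‖z j‖ < 1}) {r : Fin 2 → ℝ}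
    (h0 : ∀ j, 0 ≤ r j) (h1 : ∀ j, r j < 1) : Continuous fun ζ => u (polyPoint r ζ) :=
  hu.continuousOn.comp_continuous (continuous_polyPoint r) fun ζ => norm_polyPoint_lt h0 h1 ζ

/-- The Fourier coefficient of `u` on the polytorus with radii `r`. -/
noncomputable def polyCoeff (u : (Fin 2 → ℂ) → F) (n : Fin 2 → ℤ) (r : Fin 2 → ℝ) : F :=
  ∫ ζ, UnitAddTorus.mFourier (-n) ζ • u (polyPoint r ζ) ∂torusMeasure

theorem norm_mFourier_apply (n : Fin 2 → ℤ) (ζ : Torus) : ‖UnitAddTorus.mFourier n ζ‖ = 1 := by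
  simp only [UnitAddTorus.mFourier, fourier_apply, ContinuousMap.coe_mk, norm_prod,
    Circle.norm_coe, Finset.prod_const_one]

theorem norm_polyCoeff_le {u : (Fin 2 → ℂ) → F} {C : ℝ}
    (hC : ∀ z : Fin 2 → ℂ, (∀ j, ‖z j‖ < 1) → ‖u z‖ ≤ C) (n : Fin 2 → ℤ) {r : Fin 2 → ℝ}
    (h0 : ∀ j, 0 ≤ r j) (h1 : ∀ j, r j < 1) : ‖polyCoeff u n r‖ ≤ C := by
  refine (norm_integral_le_of_norm_le_const (C := C) (ae_of_all _ fun ζ => ?_)).trans ?_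
  · rw [norm_smul, norm_mFourier_apply, one_mul]
    exact hC _ (norm_polyPoint_lt h0 h1 ζ)
  · simp

/-- Fubini's theorem for `polyCoeff`, in both orders of integration. -/
theorem polyCoeff_eq_integral_integral (u : (Fin 2 → ℂ) → F) (n : Fin 2 → ℤ) (r : Fin 2 → ℝ)
    (hi : Integrable (fun ζ => UnitAddTorus.mFourier (-n) ζ • u (polyPoint r ζ)) torusMeasure) :
    (polyCoeff u n r = ∫ s, fourier (-n 1) s • ∫ t, fourier (-n 0) t •
      u ![(r 0 : ℂ) * (AddCircle.toCircle t : ℂ), (r 1 : ℂ) * (AddCircle.toCircle s : ℂ)]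
        ∂(AddCircle.haarAddCircle : Measure (AddCircle (1 : ℝ)))
        ∂(AddCircle.haarAddCircle : Measure (AddCircle (1 : ℝ)))) ∧
    (polyCoeff u n r = ∫ t, fourier (-n 0) t • ∫ s, fourier (-n 1) s •
      u ![(r 0 : ℂ) * (AddCircle.toCircle t : ℂ), (r 1 : ℂ) * (AddCircle.toCircle s : ℂ)]
        ∂(AddCircle.haarAddCircle : Measure (AddCircle (1 : ℝ)))
        ∂(AddCircle.haarAddCircle : Measure (AddCircle (1 : ℝ)))) := by
  have hmp := (measurePreserving_piFinTwo
    fun _ : Fin 2 => (AddCircle.haarAddCircle : Measure (AddCircle (1 : ℝ)))).symm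
  set g : AddCircle (1 : ℝ) × AddCircle (1 : ℝ) → F := fun p => (fourier (-n 0) p.1 *
    fourier (-n 1) p.2) • u ![(r 0 : ℂ) * (AddCircle.toCircle p.1 : ℂ),
      (r 1 : ℂ) * (AddCircle.toCircle p.2 : ℂ)] with hg
  have hcomp : ∀ p, UnitAddTorus.mFourier (-n)
      ((MeasurableEquiv.piFinTwo fun _ : Fin 2 => AddCircle (1 : ℝ)).symm p) •
      u (polyPoint r ((MeasurableEquiv.piFinTwo fun _ : Fin 2 => AddCircle (1 : ℝ)).symm p)) =
      g p := by
    intro p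
    simp only [hg]
    congr 1
    · simp [UnitAddTorus.mFourier, Fin.prod_univ_two, MeasurableEquiv.piFinTwo]
    · congr 1
      funext j
      fin_cases j <;> simp [polyPoint, MeasurableEquiv.piFinTwo]
  have h1 : polyCoeff u n r = ∫ p, g p ∂(
      (AddCircle.haarAddCircle : Measure (AddCircle (1 : ℝ))).prod
      (AddCircle.haarAddCircle : Measure (AddCircle (1 : ℝ)))) := by
    rw [polyCoeff, ← hmp.integral_comp' (g := fun ζ : Torus =>
      UnitAddTorus.mFourier (-n) ζ • u (polyPoint r ζ))]
    exact integral_congr_ae (ae_of_all _ hcomp)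
  have h2 : Integrable g ((AddCircle.haarAddCircle : Measure (AddCircle (1 : ℝ))).prod
      (AddCircle.haarAddCircle : Measure (AddCircle (1 : ℝ)))) := by
    have h3 := (hmp.integrable_comp_emb (MeasurableEquiv.measurableEmbedding _)).2 hi
    exact h3.congr (ae_of_all _ hcomp)
  constructor
  · rw [h1, integral_prod_symm _ h2]
    refine integral_congr_ae (ae_of_all _ fun s => ?_)
    simp only [hg]
    rw [← integral_smul]
    refine integral_congr_ae (ae_of_all _ fun t => ?_)
    simp only
    rw [smul_smul, mul_comm]
  · rw [h1, integral_prod _ h2]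
    refine integral_congr_ae (ae_of_all _ fun t => ?_)
    simp only [hg]
    rw [← integral_smul]
    refine integral_congr_ae (ae_of_all _ fun s => ?_)
    simp only
    rw [smul_smul]

theorem cons_mem_bidisk {x y : ℂ} (hx : ‖x‖ < 1) (hy : ‖y‖ < 1) :
    ![x, y] ∈ {z : Fin 2 → ℂ | ∀ j, ‖z j‖ < 1} := by
  intro j
  fin_cases j
  · exact hx
  · exact hy

/-- The dependence of the Fourier coefficients on the first radius, the second one being fixed. -/
theorem polyCoeff_zero_scale {u : (Fin 2 → ℂ) → F}
    (hu : DifferentiableOn ℂ u {z | ∀ j, ‖z j‖ < 1}) (n : Fin 2 → ℤ) {r : Fin 2 → ℝ}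
    (h0 : ∀ j, 0 ≤ r j) (h1 : ∀ j, r j < 1) {s : ℝ} (hs0 : 0 ≤ s) (hs1 : s < 1) :
    (s : ℂ) ^ (n 0).toNat • polyCoeff u n r =
      (r 0 : ℂ) ^ (n 0).toNat • polyCoeff u n ![s, r 1] ∧ (n 0 < 0 → polyCoeff u n r = 0) := by
  have hint : ∀ r : Fin 2 → ℝ, (∀ j, 0 ≤ r j) → (∀ j, r j < 1) → Integrable
      (fun ζ => UnitAddTorus.mFourier (-n) ζ • u (polyPoint r ζ)) torusMeasure :=
    fun r h0 h1 => ((UnitAddTorus.mFourier (-n)).continuous.smul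
      (continuous_comp_polyPoint hu h0 h1)).integrable_of_hasCompactSupport
        (HasCompactSupport.of_compactSpace _)
  have hslice : ∀ y : ℂ, ‖y‖ < 1 → DifferentiableOn ℂ (fun x => u ![x, y]) (Metric.ball 0 1) := by
    intro y hy
    refine hu.comp (f := fun x : ℂ => ![x, y]) ?_ fun x hx =>
      cons_mem_bidisk (by simpa using hx) hy
    refine DifferentiableOn.finCons ?_ ?_ <;> fun_prop
  rw [(polyCoeff_eq_integral_integral u n r (hint r h0 h1)).1,
    (polyCoeff_eq_integral_integral u n ![s, r 1] (hint _ (by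
      intro j; fin_cases j <;> simp [hs0, h0]) (by intro j; fin_cases j <;> simp [hs1, h1]))).1]
  simp only [Matrix.cons_val_zero, Matrix.cons_val_one]
  constructor
  · rw [← integral_smul, ← integral_smul]
    refine integral_congr_ae (ae_of_all _ fun t => ?_)
    obtain ⟨b, -, hb⟩ := exists_fourierCoeff_dilate (hslice _
      ((norm_mul_toCircle (h0 1) t).trans_lt (h1 1)))
    simp only [hb _ hs0 hs1, hb _ (h0 0) (h1 0), smul_smul]
    congr 1
    ring
  · intro hn
    rw [← integral_zero (AddCircle (1 : ℝ)) F]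
    refine integral_congr_ae (ae_of_all _ fun t => ?_)
    obtain ⟨b, hb0, hb⟩ := exists_fourierCoeff_dilate (hslice _
      ((norm_mul_toCircle (h0 1) t).trans_lt (h1 1)))
    simp only [hb _ (h0 0) (h1 0), hb0 _ hn, smul_zero]

/-- The dependence of the Fourier coefficients on the second radius, the first one being fixed. -/
theorem polyCoeff_one_scale {u : (Fin 2 → ℂ) → F}
    (hu : DifferentiableOn ℂ u {z | ∀ j, ‖z j‖ < 1}) (n : Fin 2 → ℤ) {r : Fin 2 → ℝ}
    (h0 : ∀ j, 0 ≤ r j) (h1 : ∀ j, r j < 1) {s : ℝ} (hs0 : 0 ≤ s) (hs1 : s < 1) :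
    (s : ℂ) ^ (n 1).toNat • polyCoeff u n r =
      (r 1 : ℂ) ^ (n 1).toNat • polyCoeff u n ![r 0, s] ∧ (n 1 < 0 → polyCoeff u n r = 0) := by
  have hint : ∀ r : Fin 2 → ℝ, (∀ j, 0 ≤ r j) → (∀ j, r j < 1) → Integrable
      (fun ζ => UnitAddTorus.mFourier (-n) ζ • u (polyPoint r ζ)) torusMeasure :=
    fun r h0 h1 => ((UnitAddTorus.mFourier (-n)).continuous.smul
      (continuous_comp_polyPoint hu h0 h1)).integrable_of_hasCompactSupport
        (HasCompactSupport.of_compactSpace _)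
  have hslice : ∀ x : ℂ, ‖x‖ < 1 → DifferentiableOn ℂ (fun y => u ![x, y]) (Metric.ball 0 1) := by
    intro x hx
    refine hu.comp (f := fun y : ℂ => ![x, y]) ?_ fun y hy =>
      cons_mem_bidisk hx (by simpa using hy)
    refine DifferentiableOn.finCons ?_ (DifferentiableOn.finCons ?_ ?_) <;> fun_prop
  rw [(polyCoeff_eq_integral_integral u n r (hint r h0 h1)).2,
    (polyCoeff_eq_integral_integral u n ![r 0, s] (hint _ (by
      intro j; fin_cases j <;> simp [hs0, h0]) (by intro j; fin_cases j <;> simp [hs1, h1]))).2]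
  simp only [Matrix.cons_val_zero, Matrix.cons_val_one]
  constructor
  · rw [← integral_smul, ← integral_smul]
    refine integral_congr_ae (ae_of_all _ fun t => ?_)
    obtain ⟨b, -, hb⟩ := exists_fourierCoeff_dilate (hslice _
      ((norm_mul_toCircle (h0 0) t).trans_lt (h1 0)))
    simp only [hb _ hs0 hs1, hb _ (h0 1) (h1 1), smul_smul]
    congr 1
    ring
  · intro hn
    rw [← integral_zero (AddCircle (1 : ℝ)) F]
    refine integral_congr_ae (ae_of_all _ fun t => ?_)
    obtain ⟨b, hb0, hb⟩ := exists_fourierCoeff_dilate (hslice _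
      ((norm_mul_toCircle (h0 0) t).trans_lt (h1 0)))
    simp only [hb _ (h0 1) (h1 1), hb0 _ hn, smul_zero]

/-- The Fourier coefficients of a holomorphic function on the tori of radii `r` are
`r₀ ^ n₀ * r₁ ^ n₁ • aₙ`, with `aₙ` independent of `r` and zero if some `nᵢ` is negative. -/
theorem exists_polyCoeff_eq {u : (Fin 2 → ℂ) → F}
    (hu : DifferentiableOn ℂ u {z | ∀ j, ‖z j‖ < 1}) :
    ∃ a : (Fin 2 → ℤ) → F, (∀ n, (∃ i, n i < 0) → a n = 0) ∧
      ∀ r : Fin 2 → ℝ, (∀ j, 0 ≤ r j) → (∀ j, r j < 1) → ∀ n,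
        polyCoeff u n r = (∏ j, (r j : ℂ) ^ (n j).toNat) • a n := by
  have hh : ∀ j : Fin 2, (0 : ℝ) ≤ ![1 / 2, 1 / 2] j ∧ ![(1 / 2 : ℝ), 1 / 2] j < 1 := by
    intro j; fin_cases j <;> norm_num
  -- The coefficients are read off on the torus of radii `1 / 2`.
  refine ⟨fun n => (2 : ℂ) ^ ((n 0).toNat + (n 1).toNat) • polyCoeff u n ![1 / 2, 1 / 2],
    fun n hn => ?_, fun r h0 h1 n => ?_⟩
  · have hz : polyCoeff u n ![1 / 2, 1 / 2] = 0 := by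
      obtain ⟨i, hi⟩ := hn
      fin_cases i
      · exact (polyCoeff_zero_scale hu n (fun j => (hh j).1) (fun j => (hh j).2)
          le_rfl zero_lt_one).2 hi
      · exact (polyCoeff_one_scale hu n (fun j => (hh j).1) (fun j => (hh j).2)
          le_rfl zero_lt_one).2 hi
    beta_reduce
    rw [hz, smul_zero]
  · beta_reduce
    have e0 := (polyCoeff_zero_scale hu n h0 h1 (s := 1 / 2) (by norm_num) (by norm_num)).1
    have e1 := (polyCoeff_one_scale hu n (r := ![1 / 2, r 1])
      (by intro j; fin_cases j <;> simp [h0]) (by intro j; fin_cases j <;> norm_num [h1])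
      (s := 1 / 2) (by norm_num) (by norm_num)).1
    simp only [Matrix.cons_val_zero, Matrix.cons_val_one] at e1
    have key : ∀ k : ℕ, (2 : ℂ) ^ k * (((1 / 2 : ℝ) : ℂ)) ^ k = 1 := by
      intro k
      rw [← mul_pow]
      norm_num
    rw [Fin.prod_univ_two, pow_add, smul_smul]
    calc polyCoeff u n r
        = (2 : ℂ) ^ (n 0).toNat • (((1 / 2 : ℝ) : ℂ)) ^ (n 0).toNat • polyCoeff u n r := by
          rw [smul_smul, key, one_smul]
      _ = (2 : ℂ) ^ (n 0).toNat • (r 0 : ℂ) ^ (n 0).toNat • ((2 : ℂ) ^ (n 1).toNat •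
            (((1 / 2 : ℝ) : ℂ)) ^ (n 1).toNat • polyCoeff u n ![1 / 2, r 1]) := by
          rw [e0, smul_smul ((2 : ℂ) ^ (n 1).toNat), key, one_smul]
      _ = _ := by
          rw [e1]
          simp only [smul_smul]
          congr 1
          ring

theorem exists_polyPoint_eq (z : Fin 2 → ℂ) : ∃ ζ, polyPoint (fun j => ‖z j‖) ζ = z := by
  refine ⟨fun j => ((Complex.arg (z j) / (2 * Real.pi) : ℝ) : AddCircle (1 : ℝ)),
    funext fun j => ?_⟩
  simp only [polyPoint, AddCircle.toCircle_apply_mk, Circle.coe_exp]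
  rw [show 2 * Real.pi / 1 * (Complex.arg (z j) / (2 * Real.pi)) = Complex.arg (z j) by
    field_simp]
  exact Complex.norm_mul_exp_arg_mul_I (z j)

end PowerSeries

section PowerSeriesHilbert

variable {F : Type*} [NormedAddCommGroup F] [InnerProductSpace ℂ F] [CompleteSpace F]

/-- A bounded holomorphic function on the bidisk is the sum of a power series with bounded
coefficients `aₙ`, and `r ^ |n| aₙ` are its Fourier coefficients on the torus of radius `r`. -/
theorem exists_taylorCoeff {u : (Fin 2 → ℂ) → F}
    (hu : DifferentiableOn ℂ u {z | ∀ j, ‖z j‖ < 1}) {C : ℝ}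
    (hC : ∀ z : Fin 2 → ℂ, (∀ j, ‖z j‖ < 1) → ‖u z‖ ≤ C) :
    ∃ a : (Fin 2 → ℤ) → F, (∀ n, (∃ i, n i < 0) → a n = 0) ∧
      (∀ r : ℝ, 0 ≤ r → r < 1 → ∀ n,
        ∫ ζ, UnitAddTorus.mFourier (-n) ζ • u ((r : ℂ) • torusPoint ζ) ∂torusMeasure =
          (r : ℂ) ^ ((n 0).toNat + (n 1).toNat) • a n) ∧
      ∀ z : Bidisk, HasSum (fun n : Fin 2 → ℕ => (∏ j, z.1 j ^ n j) • a fun j => (n j : ℤ))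
        (u z.1) := by
  obtain ⟨a, ha0, ha⟩ := exists_polyCoeff_eq hu
  have hbd : ∀ n, ‖a n‖ ≤ C := by
    intro n
    have hlim : Tendsto (fun r : ℝ => r ^ ((n 0).toNat + (n 1).toNat) * ‖a n‖) (𝓝[<] 1)
        (𝓝 (1 ^ ((n 0).toNat + (n 1).toNat) * ‖a n‖)) := by
      refine Tendsto.mono_left (Continuous.tendsto ?_ _) nhdsWithin_le_nhds
      fun_prop
    rw [one_pow, one_mul] at hlim
    refine le_of_tendsto hlim ?_
    filter_upwards [Ioo_mem_nhdsLT (show (0 : ℝ) < 1 by norm_num)] with r hr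
    have h := norm_polyCoeff_le hC n (r := fun _ => r) (fun _ => hr.1.le) fun _ => hr.2
    rw [ha _ (fun _ => hr.1.le) (fun _ => hr.2), norm_smul, Fin.prod_univ_two, ← pow_add,
      norm_pow, Complex.norm_real, Real.norm_of_nonneg hr.1.le] at h
    exact h
  refine ⟨a, ha0, fun r h0 h1 n => ?_, fun z => ?_⟩
  · have h := ha (fun _ => r) (fun _ => h0) (fun _ => h1) n
    rw [Fin.prod_univ_two, ← pow_add] at h
    exact h
  · have hs : Summable fun n : Fin 2 → ℕ => (∏ j, z.1 j ^ n j) • a fun j => (n j : ℤ) := by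
      refine Summable.of_norm_bounded ((summable_prod_pow z.2).mul_right C) fun n => ?_
      rw [norm_smul]
      exact mul_le_mul_of_nonneg_left (hbd _) (norm_nonneg _)
    -- The sum is identified weakly, by Fourier inversion for `⟪c, u⟫` on the torus through `z`.
    suffices h : ∑' n : Fin 2 → ℕ, (∏ j, z.1 j ^ n j) • (a fun j => (n j : ℤ)) = u z.1 by
      rw [← h]; exact hs.hasSum
    refine ext_inner_left ℂ fun c => ?_
    obtain ⟨ζ, hζ⟩ := exists_polyPoint_eq z.1
    set r : Fin 2 → ℝ := fun j => ‖z.1 j‖ with hr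
    have h0 : ∀ j, 0 ≤ r j := fun j => norm_nonneg _
    have h1 : ∀ j, r j < 1 := z.2
    have hcont := continuous_comp_polyPoint hu h0 h1
    let f : C(UnitAddTorus (Fin 2), ℂ) :=
      ⟨fun ζ => inner ℂ c (u (polyPoint r ζ)), continuous_const.inner hcont⟩
    have hcoef : ∀ n, UnitAddTorus.mFourierCoeff f n =
        (∏ j, (r j : ℂ) ^ (n j).toNat) * inner ℂ c (a n) := by
      intro n
      have h3 : UnitAddTorus.mFourierCoeff f n = ∫ ζ, inner ℂ c
          (UnitAddTorus.mFourier (-n) ζ • u (polyPoint r ζ)) ∂torusMeasure := by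
        refine integral_congr_ae (ae_of_all _ fun ζ => ?_)
        simp only [inner_smul_right, smul_eq_mul]
        rfl
      rw [h3, integral_inner, ← inner_smul_right, ← ha r h0 h1]
      · rfl
      · exact ((UnitAddTorus.mFourier (-n)).continuous.smul
          hcont).integrable_of_hasCompactSupport (HasCompactSupport.of_compactSpace _)
    have hinj : Function.Injective fun (n : Fin 2 → ℕ) (j : Fin 2) => (n j : ℤ) := by
      intro m n hmn
      funext j
      exact Nat.cast_injective (congrFun hmn j)
    have hoff : ∀ n : Fin 2 → ℤ, n ∉ Set.range (fun (n : Fin 2 → ℕ) (j : Fin 2) => (n j : ℤ)) →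
        a n = 0 := by
      intro n hn
      refine ha0 n ?_
      by_contra! hc
      exact hn ⟨fun j => (n j).toNat, funext fun j => Int.toNat_of_nonneg (hc j)⟩
    have hsum : Summable (UnitAddTorus.mFourierCoeff f) := by
      refine (hinj.summable_iff fun n hn => ?_).1 ?_
      · rw [hcoef, hoff n hn, inner_zero_right, mul_zero]
      · refine Summable.of_norm_bounded ((summable_prod_pow z.2).mul_right (‖c‖ * C)) fun n => ?_
        simp only [Function.comp, hcoef, norm_mul, norm_prod, norm_pow, Complex.norm_real,
          Int.toNat_natCast, hr, norm_norm]
        refine mul_le_mul_of_nonneg_left ?_ (by positivity)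
        exact (norm_inner_le_norm _ _).trans (mul_le_mul_of_nonneg_left (hbd _) (norm_nonneg _))
    have hF := UnitAddTorus.hasSum_mFourier_series_apply_of_summable hsum ζ
    have hF2 : HasSum (fun n : Fin 2 → ℕ => inner ℂ c ((∏ j, z.1 j ^ n j) • a fun j => (n j : ℤ)))
        (inner ℂ c (u z.1)) := by
      have h5 : f ζ = inner ℂ c (u z.1) := by
        change inner ℂ c (u (polyPoint r ζ)) = _
        rw [hζ]
      rw [← h5]
      refine ((hinj.hasSum_iff fun n hn => ?_).2 hF).congr_fun fun n => ?_
      · rw [hcoef, hoff n hn, inner_zero_right, mul_zero, zero_smul]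
      · simp only [Function.comp, hcoef, Int.toNat_natCast, inner_smul_right, smul_eq_mul]
        have h6 : ∏ j, z.1 j ^ n j =
            (∏ j, (r j : ℂ) ^ n j) * UnitAddTorus.mFourier (fun j => (n j : ℤ)) ζ := by
          simp only [UnitAddTorus.mFourier, ContinuousMap.coe_mk, ← Finset.prod_mul_distrib]
          refine Finset.prod_congr rfl fun j _ => ?_
          conv_lhs => rw [← hζ]
          rw [polyPoint, mul_pow, fourier_apply, AddCircle.toCircle_zsmul, Circle.coe_zpow,
            zpow_natCast]
        rw [h6]
        ring
    exact (hs.hasSum.mapL (innerSL ℂ c)).unique hF2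

end PowerSeriesHilbert

/-! ### Boundary values of Schur functions -/

section Boundary

variable {E Es : Type*} [NormedAddCommGroup E] [InnerProductSpace ℂ E] [CompleteSpace E]
  [NormedAddCommGroup Es] [InnerProductSpace ℂ Es] [CompleteSpace Es]

/-- Multiplication by a continuous operator-valued function on the torus. -/
noncomputable def continuousMul (φ : C(Torus, E →L[ℂ] Es)) : L2 E →L[ℂ] L2 Es :=
  (ContinuousLinearMap.id ℂ (E →L[ℂ] Es)).holderL torusMeasure ∞ 2 2
    (ContinuousMap.toLp ∞ torusMeasure ℂ φ)

theorem coeFn_continuousMul (φ : C(Torus, E →L[ℂ] Es)) (f : L2 E) :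
    continuousMul φ f =ᵐ[torusMeasure] fun ζ => φ ζ (f ζ) := by
  have h1 := ContinuousLinearMap.coeFn_holder (r := 2)
    (ContinuousLinearMap.id ℂ (E →L[ℂ] Es)) (ContinuousMap.toLp ∞ torusMeasure ℂ φ) f
  have h2 := ContinuousMap.coeFn_toLp (p := ∞) (𝕜 := ℂ) torusMeasure φ
  filter_upwards [h1, h2] with ζ h1 h2
  refine h1.trans ?_
  rw [h2]; rfl

theorem norm_continuousMul_le {φ : C(Torus, E →L[ℂ] Es)} (hφ : ∀ ζ, ‖φ ζ‖ ≤ 1) (f : L2 E) :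
    ‖continuousMul φ f‖ ≤ ‖f‖ := by
  refine Lp.norm_le_norm_of_ae_le ?_
  filter_upwards [coeFn_continuousMul φ f] with ζ h
  rw [h]
  exact ((φ ζ).le_opNorm _).trans (mul_le_of_le_one_left (norm_nonneg _) (hφ ζ))

theorem continuousMul_mulMonomial (φ : C(Torus, E →L[ℂ] Es)) (n : Fin 2 → ℤ) (f : L2 E) :
    continuousMul φ (mulMonomial E n f) = mulMonomial Es n (continuousMul φ f) := by
  refine Lp.ext ?_
  filter_upwards [coeFn_continuousMul φ (mulMonomial E n f), coeFn_mulMonomial E n f,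
    coeFn_continuousMul φ f, coeFn_mulMonomial Es n (continuousMul φ f)] with ζ h1 h2 h3 h4
  rw [h1, h2, h4, h3, map_smul]

open scoped Classical in
/-- Multiplication by the dilate `ζ ↦ Φ (r ζ)`, for those `r` for which this is continuous. -/
noncomputable def dilateMul (Φ : (Fin 2 → ℂ) → (E →L[ℂ] Es)) (r : ℝ) : L2 E →L[ℂ] L2 Es :=
  if h : Continuous fun ζ : Torus => Φ ((r : ℂ) • torusPoint ζ) then continuousMul ⟨_, h⟩ else 0

theorem norm_smul_torusPoint_lt {r : ℝ} (h0 : 0 ≤ r) (h1 : r < 1) (ζ : Torus) (j : Fin 2) :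
    ‖((r : ℂ) • torusPoint ζ) j‖ < 1 :=
  (norm_mul_toCircle h0 (ζ j)).trans_lt h1

variable {Φ : (Fin 2 → ℂ) → (E →L[ℂ] Es)}

theorem dilateMul_eq (hΦ : IsSchur Φ) {r : ℝ} (h0 : 0 ≤ r) (h1 : r < 1) :
    ∃ φ : C(Torus, E →L[ℂ] Es), (∀ ζ, φ ζ = Φ ((r : ℂ) • torusPoint ζ)) ∧
      dilateMul Φ r = continuousMul φ := by
  have hc : Continuous fun ζ : Torus => Φ ((r : ℂ) • torusPoint ζ) :=
    continuous_comp_polyPoint (r := fun _ => r) hΦ.holomorphic (fun _ => h0) fun _ => h1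
  exact ⟨⟨_, hc⟩, fun ζ => rfl, dif_pos hc⟩

theorem coeFn_dilateMul (hΦ : IsSchur Φ) {r : ℝ} (h0 : 0 ≤ r) (h1 : r < 1) (f : L2 E) :
    dilateMul Φ r f =ᵐ[torusMeasure] fun ζ => Φ ((r : ℂ) • torusPoint ζ) (f ζ) := by
  obtain ⟨φ, hφ, h⟩ := dilateMul_eq hΦ h0 h1
  rw [h]
  simpa only [hφ] using coeFn_continuousMul φ f

theorem norm_dilateMul_le (hΦ : IsSchur Φ) {r : ℝ} (h0 : 0 ≤ r) (h1 : r < 1) (f : L2 E) :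
    ‖dilateMul Φ r f‖ ≤ ‖f‖ := by
  obtain ⟨φ, hφ, h⟩ := dilateMul_eq hΦ h0 h1
  rw [h]
  refine norm_continuousMul_le (fun ζ => ?_) f
  rw [hφ]
  exact hΦ.contractive _ (norm_smul_torusPoint_lt h0 h1 ζ)

theorem coeff_dilateMul_monomial (hΦ : IsSchur Φ) {r : ℝ} (h0 : 0 ≤ r) (h1 : r < 1) (e : E)
    (n : Fin 2 → ℤ) : coeff Es n (dilateMul Φ r (monomial E 0 e)) =
      ∫ ζ, UnitAddTorus.mFourier (-n) ζ • Φ ((r : ℂ) • torusPoint ζ) e ∂torusMeasure := by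
  have h2 : coeff Es n (dilateMul Φ r (monomial E 0 e)) = ∫ ζ, UnitAddTorus.mFourier (-n) ζ •
      dilateMul Φ r (monomial E 0 e) ζ ∂torusMeasure := coeff_apply Es n _
  rw [h2]
  refine integral_congr_ae ?_
  filter_upwards [coeFn_dilateMul hΦ h0 h1 (monomial E 0 e), coeFn_monomial 0 e] with ζ h3 h4
  rw [h3, h4, UnitAddTorus.mFourier_zero]
  simp

variable [TopologicalSpace.SeparableSpace E] [TopologicalSpace.SeparableSpace Es]

/-- The dilates of `Φ e` converge in `L²`, to the function whose Fourier coefficients are the Taylor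
coefficients of `Φ e`. -/
theorem exists_tendsto_dilateMul_const (hΦ : IsSchur Φ) (e : E) :
    ∃ u ∈ H2 Es, (∀ z : Bidisk, evalAt Es z u = Φ z.1 e) ∧
      Tendsto (fun r => dilateMul Φ r (monomial E 0 e)) (𝓝[<] 1) (𝓝 u) := by
  have hev : Set.Ioo (0 : ℝ) 1 ∈ 𝓝[<] (1 : ℝ) := Ioo_mem_nhdsLT zero_lt_one
  obtain ⟨a, ha0, hac, has⟩ := exists_taylorCoeff (u := fun z => Φ z e) (C := ‖e‖)
    (hΦ.holomorphic.clm_apply (differentiableOn_const e)) fun z hz =>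
      ((Φ z).le_opNorm e).trans (mul_le_of_le_one_left (norm_nonneg _) (hΦ.contractive z hz))
  have hcoeff : ∀ r ∈ Set.Ioo (0 : ℝ) 1, ∀ n, coeff Es n (dilateMul Φ r (monomial E 0 e)) =
      (r : ℂ) ^ ((n 0).toNat + (n 1).toNat) • a n := fun r hr n => by
    rw [coeff_dilateMul_monomial hΦ hr.1.le hr.2, hac r hr.1.le hr.2]
  -- Bessel's inequality for the dilates, in the limit `r → 1` for each finite set of indices
  have hsq : Summable fun n => ‖a n‖ ^ 2 := by
    refine summable_of_sum_le (c := ‖e‖ ^ 2) (fun n => by positivity) fun s => ?_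
    have hlim : Tendsto (fun r : ℝ => ∑ n ∈ s, (r ^ ((n 0).toNat + (n 1).toNat) * ‖a n‖) ^ 2)
        (𝓝[<] 1) (𝓝 (∑ n ∈ s, (1 ^ ((n 0).toNat + (n 1).toNat) * ‖a n‖) ^ 2)) := by
      refine Tendsto.mono_left (Continuous.tendsto ?_ _) nhdsWithin_le_nhds
      fun_prop
    simp only [one_pow, one_mul] at hlim
    refine le_of_tendsto hlim ?_
    filter_upwards [hev] with r hr
    have h1 := hasSum_norm_sq_coeff (dilateMul Φ r (monomial E 0 e))
    have h2 := sum_le_hasSum s (fun n _ => by positivity) h1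
    have h3 : ‖dilateMul Φ r (monomial E 0 e)‖ ≤ ‖e‖ := by
      refine (norm_dilateMul_le hΦ hr.1.le hr.2 _).trans_eq ?_
      exact LinearIsometry.norm_map _ _
    refine le_trans (le_of_eq ?_) (h2.trans (pow_le_pow_left₀ (norm_nonneg _) h3 2))
    refine Finset.sum_congr rfl fun n _ => ?_
    rw [hcoeff r hr, norm_smul, norm_pow, Complex.norm_real, Real.norm_of_nonneg hr.1.le]
  obtain ⟨u, hu⟩ := exists_coeff_eq hsq
  refine ⟨u, mem_supportedIn.2 fun n hn => ?_, fun z => ?_, ?_⟩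
  · rw [hu]
    refine ha0 n ?_
    by_contra! hc
    exact hn hc
  · refine (hasSum_evalAt z u).unique ((has z).congr_fun fun n => ?_)
    rw [hu]
  · -- By Parseval's identity, the distance of the dilate to `u` is the sum of a dominated family.
    rw [tendsto_iff_norm_sub_tendsto_zero]
    have key : Tendsto (fun r : ℝ => ∑' n, ‖((r : ℂ) ^ ((n 0).toNat + (n 1).toNat) - 1) • a n‖ ^ 2)
        (𝓝[<] 1) (𝓝 (∑' _ : Fin 2 → ℤ, (0 : ℝ))) := by
      refine tendsto_tsum_of_dominated_convergence hsq (fun n => ?_) ?_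
      · have hlim : Tendsto (fun r : ℝ =>
            ‖((r : ℂ) ^ ((n 0).toNat + (n 1).toNat) - 1) • a n‖ ^ 2) (𝓝[<] 1)
            (𝓝 (‖(((1 : ℝ) : ℂ) ^ ((n 0).toNat + (n 1).toNat) - 1) • a n‖ ^ 2)) := by
          refine Tendsto.mono_left (Continuous.tendsto ?_ _) nhdsWithin_le_nhds
          fun_prop
        simpa using hlim
      · filter_upwards [hev] with r hr n
        rw [Real.norm_of_nonneg (by positivity), norm_smul]
        refine pow_le_pow_left₀ (by positivity) (mul_le_of_le_one_left (norm_nonneg _) ?_) 2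
        have h1 : r ^ ((n 0).toNat + (n 1).toNat) ≤ 1 := pow_le_one₀ hr.1.le hr.2.le
        have h0 : 0 ≤ r ^ ((n 0).toNat + (n 1).toNat) := pow_nonneg hr.1.le _
        rw [← Complex.ofReal_pow, ← Complex.ofReal_one, ← Complex.ofReal_sub, Complex.norm_real,
          Real.norm_eq_abs, abs_le]
        constructor <;> linarith
    rw [tsum_zero] at key
    have h2 := key.sqrt
    rw [Real.sqrt_zero] at h2
    refine h2.congr' ?_
    filter_upwards [hev] with r hr
    rw [Real.sqrt_eq_iff_eq_sq (tsum_nonneg fun n => by positivity) (norm_nonneg _)]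
    refine ((hasSum_norm_sq_coeff _).congr_fun fun n => ?_).tsum_eq
    rw [map_sub, hcoeff r hr, hu, sub_smul, one_smul]

/-- The dilates are contractions, so they converge on a closed subspace; it contains all monomials
since multiplication by `Φ` commutes with the coordinates. -/
theorem exists_tendsto_dilateMul (hΦ : IsSchur Φ) (f : L2 E) :
    ∃ u, Tendsto (fun r => dilateMul Φ r f) (𝓝[<] 1) (𝓝 u) := by
  have hev : Set.Ioo (0 : ℝ) 1 ∈ 𝓝[<] (1 : ℝ) := Ioo_mem_nhdsLT zero_lt_one
  let S : Submodule ℂ (L2 E) :=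
    { carrier := {f | ∃ u, Tendsto (fun r => dilateMul Φ r f) (𝓝[<] 1) (𝓝 u)}
      add_mem' := by
        rintro f g ⟨u, hu⟩ ⟨v, hv⟩
        exact ⟨u + v, by simpa only [map_add] using hu.add hv⟩
      zero_mem' := ⟨0, by simpa only [map_zero] using tendsto_const_nhds⟩
      smul_mem' := by
        rintro c f ⟨u, hu⟩
        exact ⟨c • u, by simpa only [map_smul] using hu.const_smul c⟩ }
  have hS : IsClosed (S : Set (L2 E)) := by
    refine isClosed_of_closure_subset fun f hf => ?_
    refine cauchy_map_iff_exists_tendsto.1 (Metric.cauchy_iff.2 ⟨inferInstance, fun ε hε => ?_⟩)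
    obtain ⟨g, ⟨u, hu⟩, hg⟩ := Metric.mem_closure_iff.1 hf (ε / 4) (by positivity)
    have hu2 := Metric.tendsto_nhds.1 hu (ε / 4) (by positivity)
    refine ⟨_, image_mem_map (inter_mem hev hu2), ?_⟩
    have key : ∀ r ∈ Set.Ioo (0 : ℝ) 1 ∩ {r | dist (dilateMul Φ r g) u < ε / 4},
        dist (dilateMul Φ r f) u < ε / 2 := by
      rintro r ⟨hr, hr2⟩
      have h1 : dist (dilateMul Φ r f) (dilateMul Φ r g) < ε / 4 := by
        refine lt_of_le_of_lt ?_ hg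
        rw [dist_eq_norm, dist_eq_norm, ← map_sub]
        exact norm_dilateMul_le hΦ hr.1.le hr.2 _
      have h2 := dist_triangle (dilateMul Φ r f) (dilateMul Φ r g) u
      have h3 : dist (dilateMul Φ r g) u < ε / 4 := hr2
      linarith
    rintro _ ⟨r, hr, rfl⟩ _ ⟨s, hs, rfl⟩
    have h2 := dist_triangle_right (dilateMul Φ r f) (dilateMul Φ s f) u
    linarith [key r hr, key s hs]
  have : CompleteSpace S := hS.completeSpace_coe
  have htop : S = ⊤ := by
    rw [← Submodule.orthogonal_eq_bot_iff, Submodule.eq_bot_iff]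
    intro g hg
    refine eq_zero_of_coeff fun n => ?_
    refine ext_inner_left ℂ fun e => ?_
    rw [inner_zero_right, ← inner_monomial_left]
    refine hg _ ?_
    obtain ⟨u, -, -, hu⟩ := exists_tendsto_dilateMul_const hΦ e
    refine ⟨mulMonomial Es n u, (((mulMonomial Es n).continuous.tendsto u).comp hu).congr' ?_⟩
    filter_upwards [hev] with r hr
    obtain ⟨φ, -, h⟩ := dilateMul_eq hΦ hr.1.le hr.2
    rw [monomial_eq_mulMonomial n e, h, continuousMul_mulMonomial, ← h]
    rfl
  have hf : f ∈ S := htop ▸ Submodule.mem_top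
  exact hf

theorem exists_isBoundaryMul (hΦ : IsSchur Φ) : ∃ T : L2 E →L[ℂ] L2 Es, IsBoundaryMul Φ T ∧
    ∀ f, Tendsto (fun r => dilateMul Φ r f) (𝓝[<] 1) (𝓝 (T f)) := by
  choose u hu using exists_tendsto_dilateMul hΦ
  refine ⟨continuousLinearMapOfTendsto (dilateMul Φ) (f := u) (tendsto_pi_nhds.2 hu),
    fun f => ?_, hu⟩
  refine (tendsto_iff_edist_tendsto_0.1 (hu f)).congr' ?_
  filter_upwards [Ioo_mem_nhdsLT (show (0 : ℝ) < 1 by norm_num)] with r hr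
  rw [Lp.edist_def]
  refine eLpNorm_congr_ae ?_
  filter_upwards [coeFn_dilateMul hΦ hr.1.le hr.2 f] with ζ h
  rw [Pi.sub_apply, h]
  rfl

theorem tendsto_dilateMul (hΦ : IsSchur Φ) (f : L2 E) :
    Tendsto (fun r => dilateMul Φ r f) (𝓝[<] 1) (𝓝 (boundaryMul Φ f)) := by
  obtain ⟨T, hT, hlim⟩ := exists_isBoundaryMul hΦ
  have h : ∃ T, IsBoundaryMul Φ T := ⟨T, hT⟩
  have h2 : boundaryMul Φ = T := by
    rw [boundaryMul, dif_pos h]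
    exact h.choose_spec.unique hΦ hT
  rw [h2]
  exact hlim f

theorem norm_boundaryMul_le (hΦ : IsSchur Φ) (f : L2 E) : ‖boundaryMul Φ f‖ ≤ ‖f‖ := by
  refine le_of_tendsto (tendsto_dilateMul hΦ f).norm ?_
  filter_upwards [Ioo_mem_nhdsLT (show (0 : ℝ) < 1 by norm_num)] with r hr
  exact norm_dilateMul_le hΦ hr.1.le hr.2 f

theorem boundaryMul_const_mem_H2 (hΦ : IsSchur Φ) (e : E) :
    boundaryMul Φ (monomial E 0 e) ∈ H2 Es := by
  obtain ⟨u, hu, -, hlim⟩ := exists_tendsto_dilateMul_const hΦ e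
  rwa [tendsto_nhds_unique (tendsto_dilateMul hΦ _) hlim]

theorem evalAt_boundaryMul_const (hΦ : IsSchur Φ) (z : Bidisk) (e : E) :
    evalAt Es z (boundaryMul Φ (monomial E 0 e)) = Φ z.1 e := by
  obtain ⟨u, -, hu, hlim⟩ := exists_tendsto_dilateMul_const hΦ e
  rw [tendsto_nhds_unique (tendsto_dilateMul hΦ _) hlim, hu]

/-- Multiplication by `Φ` preserves the functions with Fourier support in a half-plane `nᵢ ≥ 0`. -/
theorem boundaryMul_mem_supportedIn (hΦ : IsSchur Φ) (i : Fin 2) {f : L2 E}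
    (hf : f ∈ supportedIn E {n | 0 ≤ n i}) : boundaryMul Φ f ∈ supportedIn Es {n | 0 ≤ n i} := by
  refine mem_supportedIn.2 fun m hm => ?_
  have h := (hasSum_monomial_coeff f).mapL (coeff Es m ∘L boundaryMul Φ)
  refine h.unique (hasSum_zero.congr_fun fun n => ?_)
  by_cases hn : n ∈ {n : Fin 2 → ℤ | 0 ≤ n i}
  · rw [ContinuousLinearMap.comp_apply, monomial_eq_mulMonomial, boundaryMul_mulMonomial hΦ,
      coeff_mulMonomial, mem_supportedIn.1 (boundaryMul_const_mem_H2 hΦ _)]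
    intro hc
    have h1 : 0 ≤ m i - n i := hc i
    have h2 : 0 ≤ n i := hn
    exact hm (by change 0 ≤ m i; linarith)
  · rw [mem_supportedIn.1 hf n hn, map_zero, map_zero]

theorem H2_eq_inf : H2 E = ⨅ i, supportedIn E {n | 0 ≤ n i} := by
  ext f
  simp only [Submodule.mem_iInf, mem_supportedIn, Set.mem_ofPred_eq, not_forall]
  exact ⟨fun h i n hn => h n ⟨i, hn⟩, fun h n ⟨i, hn⟩ => h i n hn⟩

theorem boundaryMul_mem_H2 (hΦ : IsSchur Φ) {f : L2 E} (hf : f ∈ H2 E) :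
    boundaryMul Φ f ∈ H2 Es := by
  rw [H2_eq_inf, Submodule.mem_iInf] at hf ⊢
  exact fun i => boundaryMul_mem_supportedIn hΦ i (hf i)

/-- On `H²(E)`, multiplication by the boundary values of `Φ` is pointwise multiplication by `Φ` on
the bidisk. -/
theorem evalAt_boundaryMul (hΦ : IsSchur Φ) (z : Bidisk) {f : L2 E} (hf : f ∈ H2 E) :
    evalAt Es z (boundaryMul Φ f) = Φ z.1 (evalAt E z f) := by
  have h1 := (hasSum_monomial_coeff f).mapL (evalAt Es z ∘L boundaryMul Φ)
  have h2 := (hasSum_monomial_coeff f).mapL (Φ z.1 ∘L evalAt E z)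
  refine h1.unique (h2.congr_fun fun n => ?_)
  simp only [ContinuousLinearMap.comp_apply]
  by_cases hn : ∀ i, 0 ≤ n i
  · lift n to Fin 2 → ℕ using hn
    rw [monomial_eq_mulMonomial, boundaryMul_mulMonomial hΦ]
    rw [evalAt_mulMonomial z n (boundaryMul_const_mem_H2 hΦ _), evalAt_boundaryMul_const hΦ,
      evalAt_mulMonomial z n (monomial_mem_supportedIn (by simp) _), map_smul]
    have h0 := evalAt_monomial z 0 (coeff E (fun j => (n j : ℤ)) f)
    simp only [Pi.zero_apply, pow_zero, Finset.prod_const_one, one_smul] at h0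
    congr 2
    exact h0.symm
  · rw [mem_supportedIn.1 hf n hn]
    simp only [map_zero]

/-- The adjoint of multiplication by `Φ` preserves the functions with Fourier support in a
half-plane `nᵢ < 0`. -/
theorem adjoint_boundaryMul_mem_supportedIn (hΦ : IsSchur Φ) (i : Fin 2) {f : L2 Es}
    (hf : f ∈ supportedIn Es {n | n i < 0}) :
    (boundaryMul Φ).adjoint f ∈ supportedIn E {n | n i < 0} := by
  have hset : {n : Fin 2 → ℤ | n i < 0} = {n : Fin 2 → ℤ | 0 ≤ n i}ᶜ := by
    ext n; simp
  rw [hset, ← supportedIn_orthogonal] at hf ⊢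
  intro g hg
  rw [ContinuousLinearMap.adjoint_inner_right]
  exact hf _ (boundaryMul_mem_supportedIn hΦ i hg)

/-- The reproducing kernel of `H²(Es)` composed with `Φ P Φ*`, where `P` is the projection onto
`H²(E)`, is `Φ(z) Φ(w)*` times the Szegő kernel. -/
theorem evalAt_boundaryMul_starProjection_adjoint (hΦ : IsSchur Φ) (z w : Bidisk) (e : Es) :
    evalAt Es z (boundaryMul Φ ((H2 E).starProjection ((boundaryMul Φ).adjoint
      ((evalAt Es w).adjoint e)))) =
    ((1 - z.1 0 * conj (w.1 0)) * (1 - z.1 1 * conj (w.1 1)))⁻¹ • Φ z.1 ((Φ w.1).adjoint e) := by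
  rw [evalAt_boundaryMul hΦ z (Submodule.starProjection_apply_mem _ _), evalAt_starProjection,
    ← map_smul]
  congr 1
  refine ext_inner_left ℂ fun c => ?_
  rw [← ContinuousLinearMap.adjoint_inner_left, ContinuousLinearMap.adjoint_inner_right,
    ContinuousLinearMap.adjoint_inner_right, evalAt_boundaryMul hΦ w (adjoint_evalAt_mem_H2 z c),
    evalAt_adjoint_evalAt, map_smul, inner_smul_left, inner_smul_right,
    ContinuousLinearMap.adjoint_inner_right]
  congr 1
  simp only [map_inv₀, map_mul, map_sub, map_one, Complex.conj_conj]
  simp only [mul_comm]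

end Boundary

/-! ### The model space -/

section Sqrt

variable {H : Type*} [NormedAddCommGroup H] [InnerProductSpace ℂ H] [CompleteSpace H]

theorem opSqrt_opSqrt {A : H →L[ℂ] H} (hA : A.IsPositive) (x : H) :
    opSqrt A (opSqrt A x) = A x := by
  have h := CFC.sqrt_mul_sqrt_self A ((ContinuousLinearMap.nonneg_iff_isPositive A).2 hA)
  exact congrArg (fun C : H →L[ℂ] H => C x) h

theorem isPositive_opSqrt (A : H →L[ℂ] H) : (opSqrt A).IsPositive :=
  (ContinuousLinearMap.nonneg_iff_isPositive _).1 (CFC.sqrt_nonneg A)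

/-- An element of the form `A x` of the operator range of `√A`, regarded as an element of this
operator range, represents the functional `F ↦ ⟪x, F⟫`. -/
noncomputable def sqrtRangeElt (A : H →L[ℂ] H) : H →L[ℂ] OperatorRange (opSqrt A) :=
  OperatorRange.mk (opSqrt A) ∘L opSqrt A

theorem incl_sqrtRangeElt {A : H →L[ℂ] H} (hA : A.IsPositive) (x : H) :
    OperatorRange.incl (opSqrt A) (sqrtRangeElt A x) = A x := by
  rw [sqrtRangeElt, ContinuousLinearMap.comp_apply, OperatorRange.incl_mk, opSqrt_opSqrt hA]

theorem inner_sqrtRangeElt (A : H →L[ℂ] H) (x : H) (F : OperatorRange (opSqrt A)) :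
    inner ℂ (sqrtRangeElt A x) F = inner ℂ x (OperatorRange.incl (opSqrt A) F) := by
  have h : inner ℂ (sqrtRangeElt A x) F =
      inner ℂ (opSqrt A x) (OperatorRange.preimage (opSqrt A) F) :=
    Submodule.inner_orthogonalProjectionOnto_eq_of_mem_right _ _
  rw [h, (isPositive_opSqrt A).inner_left_eq_inner_right]
  rfl

end Sqrt

section Model

variable {E Es : Type*} [NormedAddCommGroup E] [InnerProductSpace ℂ E] [CompleteSpace E]
  [NormedAddCommGroup Es] [InnerProductSpace ℂ Es] [CompleteSpace Es]
  [TopologicalSpace.SeparableSpace E] [TopologicalSpace.SeparableSpace Es]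
  {Φ : (Fin 2 → ℂ) → (E →L[ℂ] Es)}

theorem inner_modelOp_self (F : L2Sum E Es) : inner ℂ (modelOp Φ F) F =
    inner ℂ F.fst F.fst + inner ℂ (boundaryMul Φ F.snd) F.fst +
      (inner ℂ F.fst (boundaryMul Φ F.snd) + inner ℂ F.snd F.snd) := by
  have h : inner ℂ (modelOp Φ F) F = inner ℂ (F.fst + boundaryMul Φ F.snd) F.fst +
      inner ℂ ((boundaryMul Φ).adjoint F.fst + F.snd) F.snd := rfl
  rw [h, inner_add_left, inner_add_left, ContinuousLinearMap.adjoint_inner_left]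

/-- The quadratic form of `[I, Φ; Φ*, I]` is `‖F₁‖² + ‖F₂‖² + 2 Re ⟪F₁, Φ F₂⟫`, and `Φ` is a
contraction. -/
theorem isPositive_modelOp (hΦ : IsSchur Φ) : (modelOp Φ).IsPositive := by
  have h : ∀ F : L2Sum E Es, inner ℂ (modelOp Φ F) F = ((‖F.fst‖ ^ 2 + ‖F.snd‖ ^ 2 +
      2 * (inner ℂ F.fst (boundaryMul Φ F.snd)).re : ℝ) : ℂ) := by
    intro F
    rw [inner_modelOp_self, inner_self_eq_norm_sq_to_K, inner_self_eq_norm_sq_to_K,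
      ← inner_conj_symm]
    have := Complex.add_conj (inner ℂ F.fst (boundaryMul Φ F.snd))
    push_cast at this ⊢
    simp only [Complex.coe_algebraMap]
    linear_combination this
  have hp : (modelOp Φ).toLinearMap.IsPositive := by
    refine (LinearMap.isPositive_iff_complex _).2 fun F => ?_
    have h2 : inner ℂ ((modelOp Φ).toLinearMap F) F = _ := h F
    rw [h2]
    refine ⟨by rw [RCLike.re_eq_complex_re, Complex.ofReal_re], ?_⟩
    have h3 := (RCLike.re_le_norm (-inner ℂ F.fst (boundaryMul Φ F.snd))).trans_eq (norm_neg _)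
    have h4 := norm_inner_le_norm (𝕜 := ℂ) F.fst (boundaryMul Φ F.snd)
    have h5 := mul_le_mul_of_nonneg_left (norm_boundaryMul_le hΦ F.snd) (norm_nonneg F.fst)
    simp only [map_neg, RCLike.re_eq_complex_re, Complex.ofReal_re] at h3 ⊢
    nlinarith [sq_nonneg (‖F.fst‖ - ‖F.snd‖)]
  exact hp

variable (Φ) in
/-- The element `[Φ; I] g` of the model space. -/
noncomputable def outElt : L2 E →L[ℂ] Model Φ :=
  sqrtRangeElt (modelOp Φ) ∘L
    (WithLp.prodContinuousLinearEquiv 2 ℂ (L2 Es) (L2 E)).symm.toContinuousLinearMap ∘L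
      ContinuousLinearMap.inr ℂ (L2 Es) (L2 E)

variable (Φ) in
/-- The element `[I; Φ*] f` of the model space. -/
noncomputable def inElt : L2 Es →L[ℂ] Model Φ :=
  sqrtRangeElt (modelOp Φ) ∘L
    (WithLp.prodContinuousLinearEquiv 2 ℂ (L2 Es) (L2 E)).symm.toContinuousLinearMap ∘L
      ContinuousLinearMap.inl ℂ (L2 Es) (L2 E)

theorem toPair_ext {F G : Model Φ} (h1 : (toPair Φ F).fst = (toPair Φ G).fst)
    (h2 : (toPair Φ F).snd = (toPair Φ G).snd) : F = G := by
  refine OperatorRange.incl_injective _ ?_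
  apply (WithLp.prodContinuousLinearEquiv 2 ℂ (L2 Es) (L2 E)).injective
  exact Prod.ext h1 h2

theorem toPair_outElt (hΦ : IsSchur Φ) (g : L2 E) : toPair Φ (outElt Φ g) = colPhi Φ g := by
  refine (incl_sqrtRangeElt (isPositive_modelOp hΦ) _).trans ?_
  apply (WithLp.prodContinuousLinearEquiv 2 ℂ (L2 Es) (L2 E)).injective
  refine Prod.ext (zero_add _) ?_
  change (boundaryMul Φ).adjoint 0 + g = g
  rw [map_zero, zero_add]

theorem toPair_inElt (hΦ : IsSchur Φ) (f : L2 Es) : toPair Φ (inElt Φ f) = colPhiStar Φ f := by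
  refine (incl_sqrtRangeElt (isPositive_modelOp hΦ) _).trans ?_
  apply (WithLp.prodContinuousLinearEquiv 2 ℂ (L2 Es) (L2 E)).injective
  refine Prod.ext ?_ (add_zero _)
  change f + boundaryMul Φ 0 = f
  rw [map_zero, add_zero]

theorem toPair_outElt_fst (hΦ : IsSchur Φ) (g : L2 E) :
    (toPair Φ (outElt Φ g)).fst = boundaryMul Φ g := by rw [toPair_outElt hΦ]; rfl

theorem toPair_outElt_snd (hΦ : IsSchur Φ) (g : L2 E) : (toPair Φ (outElt Φ g)).snd = g := by
  rw [toPair_outElt hΦ]; rfl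

theorem toPair_inElt_fst (hΦ : IsSchur Φ) (f : L2 Es) : (toPair Φ (inElt Φ f)).fst = f := by
  rw [toPair_inElt hΦ]; rfl

theorem toPair_inElt_snd (hΦ : IsSchur Φ) (f : L2 Es) :
    (toPair Φ (inElt Φ f)).snd = (boundaryMul Φ).adjoint f := by rw [toPair_inElt hΦ]; rfl

theorem inner_outElt (g : L2 E) (F : Model Φ) :
    inner ℂ (outElt Φ g) F = inner ℂ g (toPair Φ F).snd := by
  refine (inner_sqrtRangeElt (modelOp Φ) _ F).trans ?_
  have h : inner ℂ ((WithLp.prodContinuousLinearEquiv 2 ℂ (L2 Es) (L2 E)).symm (0, g))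
    (toPair Φ F) = inner ℂ (0 : L2 Es) (toPair Φ F).fst + inner ℂ g (toPair Φ F).snd := rfl
  rw [inner_zero_left, zero_add] at h
  exact h

theorem inner_inElt (f : L2 Es) (F : Model Φ) :
    inner ℂ (inElt Φ f) F = inner ℂ f (toPair Φ F).fst := by
  refine (inner_sqrtRangeElt (modelOp Φ) _ F).trans ?_
  have h : inner ℂ ((WithLp.prodContinuousLinearEquiv 2 ℂ (L2 Es) (L2 E)).symm (f, 0))
    (toPair Φ F) = inner ℂ f (toPair Φ F).fst + inner ℂ (0 : L2 E) (toPair Φ F).snd := rfl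
  rw [inner_zero_left, add_zero] at h
  exact h

theorem inModel_map_colPhi (hΦ : IsSchur Φ) (N : Submodule ℂ (L2 E)) :
    inModel Φ (N.map (colPhi Φ).toLinearMap) = N.map (outElt Φ).toLinearMap := by
  ext F
  constructor
  · rintro ⟨g, hg, h⟩
    refine ⟨g, hg, OperatorRange.incl_injective _ ?_⟩
    exact (toPair_outElt hΦ g).trans h
  · rintro ⟨g, hg, rfl⟩
    exact ⟨g, hg, (toPair_outElt hΦ g).symm⟩

theorem inModel_map_colPhiStar (hΦ : IsSchur Φ) (N : Submodule ℂ (L2 Es)) :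
    inModel Φ (N.map (colPhiStar Φ).toLinearMap) = N.map (inElt Φ).toLinearMap := by
  ext F
  constructor
  · rintro ⟨g, hg, h⟩
    refine ⟨g, hg, OperatorRange.incl_injective _ ?_⟩
    exact (toPair_inElt hΦ g).trans h
  · rintro ⟨g, hg, rfl⟩
    exact ⟨g, hg, (toPair_inElt hΦ g).symm⟩

/-! ### The scattering subspace -/

instance : (scattering Φ).HasOrthogonalProjection :=
  inferInstanceAs ((outgoing Φ ⊔ incoming Φ)ᗮ).HasOrthogonalProjection

theorem fin_two_eq_of_ne {i j l : Fin 2} (hi : i ≠ l) (hj : j ≠ l) : i = j := by lia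

/-- The scattering subspace `K_Φ` consists of the elements with the first component in `H²(Es)` and
the second one orthogonal to `H²(E)`. -/
theorem mem_scattering (hΦ : IsSchur Φ) {F : Model Φ} :
    F ∈ scattering Φ ↔ (toPair Φ F).fst ∈ H2 Es ∧ (toPair Φ F).snd ∈ (H2 E)ᗮ := by
  have h1 : F ∈ (outgoing Φ)ᗮ ↔ (toPair Φ F).snd ∈ (H2 E)ᗮ := by
    rw [outgoing, inModel_map_colPhi hΦ, Submodule.mem_orthogonal, Submodule.mem_orthogonal]
    simp only [Submodule.mem_map, forall_exists_index, and_imp, forall_apply_eq_imp_iff₂]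
    exact forall₂_congr fun g _ => by
      rw [← inner_outElt]; rfl
  have h2 : F ∈ (incoming Φ)ᗮ ↔ (toPair Φ F).fst ∈ H2 Es := by
    rw [← (H2 Es).orthogonal_orthogonal]
    rw [incoming, inModel_map_colPhiStar hΦ, Submodule.mem_orthogonal, Submodule.mem_orthogonal]
    simp only [Submodule.mem_map, forall_exists_index, and_imp, forall_apply_eq_imp_iff₂]
    exact forall₂_congr fun g _ => by
      rw [← inner_inElt]; rfl
  rw [scattering, ← Submodule.inf_orthogonal, Submodule.mem_inf, h1, h2, and_comm]

theorem outElt_mem_scattering_orthogonal (hΦ : IsSchur Φ) {g : L2 E} (hg : g ∈ H2 E) :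
    outElt Φ g ∈ (scattering Φ)ᗮ := by
  intro F hF
  rw [← inner_conj_symm, inner_outElt, ((mem_scattering hΦ).1 hF).2 g hg, map_zero]

theorem inElt_mem_scattering_orthogonal (hΦ : IsSchur Φ) {f : L2 Es} (hf : f ∈ (H2 Es)ᗮ) :
    inElt Φ f ∈ (scattering Φ)ᗮ := by
  intro F hF
  rw [← inner_conj_symm, inner_inElt, Submodule.inner_left_of_mem_orthogonal
    ((mem_scattering hΦ).1 hF).1 hf, map_zero]

/-- For `f ∈ H²(Es)`, the projection of `[I; Φ*] f` on the scattering subspace has the first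
component `f - Φ P Φ* f`, where `P` is the projection on `H²(E)`. -/
theorem scatteringProj_inElt_fst (hΦ : IsSchur Φ) {f : L2 Es} (hf : f ∈ H2 Es) :
    (toPair Φ (scatteringProj Φ (inElt Φ f))).fst =
      f - boundaryMul Φ ((H2 E).starProjection ((boundaryMul Φ).adjoint f)) := by
  set g := (H2 E).starProjection ((boundaryMul Φ).adjoint f) with hg
  have hgH : g ∈ H2 E := Submodule.starProjection_apply_mem _ _
  have h : (scattering Φ).starProjection (inElt Φ f) = inElt Φ f - outElt Φ g := by
    refine Submodule.eq_starProjection_of_mem_orthogonal ((mem_scattering hΦ).2 ⟨?_, ?_⟩) ?_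
    · rw [map_sub, WithLp.sub_fst, toPair_inElt_fst hΦ, toPair_outElt_fst hΦ]
      exact sub_mem hf (boundaryMul_mem_H2 hΦ hgH)
    · rw [map_sub, WithLp.sub_snd, toPair_inElt_snd hΦ, toPair_outElt_snd hΦ]
      exact Submodule.sub_starProjection_mem_orthogonal _
    · rw [sub_sub_cancel]
      exact outElt_mem_scattering_orthogonal hΦ hgH
  rw [Submodule.starProjection_apply] at h
  rw [h, map_sub, WithLp.sub_fst, toPair_inElt_fst hΦ, toPair_outElt_fst hΦ]

theorem toPair_modelZ_fst (hΦ : IsSchur Φ) (j : Fin 2) (F : Model Φ) :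
    (toPair Φ (modelZ Φ j F)).fst = mulMonomial Es (Pi.single j 1) (toPair Φ F).fst := by
  rw [toPair_modelZ hΦ]; rfl

theorem toPair_modelZ_snd (hΦ : IsSchur Φ) (j : Fin 2) (F : Model Φ) :
    (toPair Φ (modelZ Φ j F)).snd = mulMonomial E (Pi.single j 1) (toPair Φ F).snd := by
  rw [toPair_modelZ hΦ]; rfl

theorem modelZ_outElt (hΦ : IsSchur Φ) (j : Fin 2) (g : L2 E) :
    modelZ Φ j (outElt Φ g) = outElt Φ (mulMonomial E (Pi.single j 1) g) := by
  refine toPair_ext ?_ ?_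
  · rw [toPair_modelZ_fst hΦ, toPair_outElt_fst hΦ, toPair_outElt_fst hΦ,
      boundaryMul_mulMonomial hΦ]
  · rw [toPair_modelZ_snd hΦ, toPair_outElt_snd hΦ, toPair_outElt_snd hΦ]

theorem modelZ_inElt (hΦ : IsSchur Φ) (j : Fin 2) (f : L2 Es) :
    modelZ Φ j (inElt Φ f) = inElt Φ (mulMonomial Es (Pi.single j 1) f) := by
  refine toPair_ext ?_ ?_
  · rw [toPair_modelZ_fst hΦ, toPair_inElt_fst hΦ, toPair_inElt_fst hΦ]
  · rw [toPair_modelZ_snd hΦ, toPair_inElt_snd hΦ, toPair_inElt_snd hΦ,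
      adjoint_boundaryMul_mulMonomial hΦ]

theorem inner_mulZ_mulZ (j : Fin 2) (F G : L2Sum E Es) :
    inner ℂ (mulZ E Es j F) (mulZ E Es j G) = inner ℂ F G := by
  have h : inner ℂ (mulZ E Es j F) (mulZ E Es j G) =
    inner ℂ (mulMonomial Es (Pi.single j 1) F.fst) (mulMonomial Es (Pi.single j 1) G.fst) +
    inner ℂ (mulMonomial E (Pi.single j 1) F.snd) (mulMonomial E (Pi.single j 1) G.snd) := rfl
  rw [h, inner_mulMonomial_mulMonomial, inner_mulMonomial_mulMonomial]
  rfl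

theorem exists_mulZ_eq (j : Fin 2) (F : L2Sum E Es) : ∃ G, mulZ E Es j G = F := by
  refine ⟨WithLp.toLp 2 (mulMonomial Es (-Pi.single j 1) F.fst,
    mulMonomial E (-Pi.single j 1) F.snd), ?_⟩
  apply (WithLp.prodContinuousLinearEquiv 2 ℂ (L2 Es) (L2 E)).injective
  refine Prod.ext ?_ ?_
  · change mulMonomial Es (Pi.single j 1) (mulMonomial Es (-Pi.single j 1) F.fst) = F.fst
    rw [mulMonomial_mulMonomial, add_neg_cancel, mulMonomial_zero]
  · change mulMonomial E (Pi.single j 1) (mulMonomial E (-Pi.single j 1) F.snd) = F.snd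
    rw [mulMonomial_mulMonomial, add_neg_cancel, mulMonomial_zero]

theorem inner_modelZ_modelZ (hΦ : IsSchur Φ) (j : Fin 2) (F G : Model Φ) :
    inner ℂ (modelZ Φ j F) (modelZ Φ j G) = inner ℂ F G := by
  set S := opSqrt (modelOp Φ) with hS
  -- `Z_j` is unitary and commutes with the square root, so it preserves `(ker S)ᗮ`.
  have hker : mulZ E Es j (OperatorRange.preimage S F) ∈ (LinearMap.ker S.toLinearMap)ᗮ := by
    intro x hx
    obtain ⟨y, rfl⟩ := exists_mulZ_eq j x
    rw [inner_mulZ_mulZ]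
    refine Subtype.property F y ?_
    have h1 : S (mulZ E Es j y) = 0 := hx
    rw [hS, opSqrt_modelOp_mulZ hΦ] at h1
    have h2 := inner_mulZ_mulZ j (opSqrt (modelOp Φ) y) (opSqrt (modelOp Φ) y)
    rw [h1, inner_zero_left, eq_comm, inner_self_eq_zero] at h2
    exact h2
  have h : inner ℂ (modelZ Φ j F) (modelZ Φ j G) =
      inner ℂ ((LinearMap.ker S.toLinearMap)ᗮ.starProjection
        (mulZ E Es j (OperatorRange.preimage S F))) (mulZ E Es j (OperatorRange.preimage S G)) :=
    OperatorRange.inner_mk_mk S _ _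
  rw [h, Submodule.starProjection_eq_self_iff.2 hker, inner_mulZ_mulZ]
  rfl

theorem coeff_modelZ_pow_fst (hΦ : IsSchur Φ) (j : Fin 2) (k : ℕ) (F : Model Φ)
    (n : Fin 2 → ℤ) : coeff Es n (toPair Φ ((modelZ Φ j ^ k) F)).fst =
      coeff Es (n - Pi.single j (k : ℤ)) (toPair Φ F).fst := by
  induction k generalizing n with
  | zero => simp
  | succ k ih =>
    rw [pow_succ', mul_apply_eq_comp, toPair_modelZ_fst hΦ, coeff_mulMonomial, ih,
      sub_sub, ← Pi.single_add, Nat.cast_succ, add_comm]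

theorem coeff_modelZ_pow_snd (hΦ : IsSchur Φ) (j : Fin 2) (k : ℕ) (F : Model Φ)
    (n : Fin 2 → ℤ) : coeff E n (toPair Φ ((modelZ Φ j ^ k) F)).snd =
      coeff E (n - Pi.single j (k : ℤ)) (toPair Φ F).snd := by
  induction k generalizing n with
  | zero => simp
  | succ k ih =>
    rw [pow_succ', mul_apply_eq_comp, toPair_modelZ_snd hΦ, coeff_mulMonomial, ih,
      sub_sub, ← Pi.single_add, Nat.cast_succ, add_comm]

/-! ### The subspaces `S_j^max` and `S_j^min` -/

/-- Fourier coefficients at `n` of the second component are shifted by `Z_jᵏ`, for large `k`, to an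
index with nonnegative `j`-th coordinate, where only the other coordinate can keep it out of
`H²(E)`. -/
theorem mem_Smax (hΦ : IsSchur Φ) (j : Fin 2) {F : scattering Φ} :
    F ∈ Smax Φ j ↔ (toPair Φ F).snd ∈ supportedIn E {n | ∀ i, i ≠ j → n i < 0} := by
  have hF := (mem_scattering hΦ).1 F.2
  rw [supportedIn_orthogonal] at hF
  have hdef : F ∈ Smax Φ j ↔ ∀ k : ℕ, (modelZ Φ j ^ k) F ∈ scattering Φ := by
    simp only [Smax, Submodule.mem_iInf]
    rfl
  rw [hdef]
  constructor
  · refine fun h => mem_supportedIn.2 fun n hn => ?_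
    have h2 := ((mem_scattering hΦ).1 (h (n j).natAbs)).2
    rw [supportedIn_orthogonal, mem_supportedIn] at h2
    have h3 := h2 (n + Pi.single j ((n j).natAbs : ℤ)) ?_
    · rwa [coeff_modelZ_pow_snd hΦ, add_sub_cancel_right] at h3
    · rw [Set.notMem_compl_iff]
      intro i
      rw [Pi.add_apply]
      by_cases hi : i = j
      · subst hi
        rw [Pi.single_eq_same]
        lia
      · rw [Pi.single_eq_of_ne hi, add_zero]
        -- the only index other than `j` violating negativity is `i`
        have h5 : ¬ ∀ i, i ≠ j → n i < 0 := hn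
        push Not at h5
        obtain ⟨i', hi', h6⟩ := h5
        have : i = i' := fin_two_eq_of_ne hi hi'
        rwa [this]
  · refine fun h k => (mem_scattering hΦ).2 ⟨mem_supportedIn.2 fun n hn => ?_, ?_⟩
    · rw [coeff_modelZ_pow_fst hΦ]
      refine mem_supportedIn.1 hF.1 _ fun hc => hn fun i => ?_
      have h1 := hc i
      rw [Pi.sub_apply] at h1
      have h2 : 0 ≤ (Pi.single j (k : ℤ) : Fin 2 → ℤ) i := by
        by_cases hi : i = j
        · subst hi; simp
        · simp [hi]
      linarith
    · rw [supportedIn_orthogonal]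
      refine mem_supportedIn.2 fun n hn => ?_
      rw [coeff_modelZ_pow_snd hΦ]
      refine mem_supportedIn.1 h _ fun hc => ?_
      rw [Set.notMem_compl_iff] at hn
      obtain ⟨i, hi⟩ := exists_ne j
      have h1 := hc i hi
      rw [Pi.sub_apply, Pi.single_eq_of_ne hi, sub_zero] at h1
      have h2 := hn i
      linarith

/-- Within `K_Φ`, the orthogonal complement of `S_j^min` is `S_i^max` for the other index `i`. -/
theorem Smin_orthogonal (hΦ : IsSchur Φ) {i j : Fin 2} (hij : i ≠ j) :
    (Smin Φ j)ᗮ = Smax Φ i := by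
  ext F
  have hF := ((mem_scattering hΦ).1 F.2).2
  rw [supportedIn_orthogonal] at hF
  have h1 : F ∈ (Smin Φ j)ᗮ ↔ (toPair Φ F).snd ∈ (mixed E j)ᗮ := by
    rw [Smin, Submodule.orthogonal_closure, inModel_map_colPhi hΦ, Submodule.mem_orthogonal,
      Submodule.mem_orthogonal]
    simp only [Submodule.mem_map, forall_exists_index, and_imp, forall_apply_eq_imp_iff₂]
    refine forall₂_congr fun g _ => ?_
    rw [← inner_outElt, ← Submodule.inner_orthogonalProjectionOnto_eq_of_mem_right]
    rfl
  rw [h1, mem_Smax hΦ, supportedIn_orthogonal, mem_supportedIn, mem_supportedIn]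
  rw [mem_supportedIn] at hF
  constructor
  · intro h n hn
    by_cases h2 : n ∈ {n : Fin 2 → ℤ | ∀ i, 0 ≤ n i}
    · exact hF n (not_not.2 h2)
    · refine h n (not_not.2 ?_)
      have h3 : ¬ ∀ l, l ≠ i → n l < 0 := hn
      have h4 : ¬ ∀ l, 0 ≤ n l := h2
      push Not at h3 h4
      obtain ⟨l, hl, h3⟩ := h3
      obtain ⟨l', h4⟩ := h4
      have e1 : l = j := fin_two_eq_of_ne hl hij.symm
      have e2 : l' ≠ j := by rintro rfl; rw [e1] at h3; linarith
      refine ⟨e1 ▸ h3, fun m hm => ?_⟩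
      have e3 : m = l' := fin_two_eq_of_ne hm e2
      rwa [e3]
  · intro h n hn
    rw [Set.notMem_compl_iff] at hn
    refine h n fun hc => ?_
    have h2 := hc j hij.symm
    have h3 := hn.1
    linarith

theorem isClosed_Smin (j : Fin 2) : IsClosed (Smin Φ j : Set (scattering Φ)) :=
  Submodule.isClosed_topologicalClosure _

theorem Smax_orthogonal (hΦ : IsSchur Φ) {i j : Fin 2} (hij : i ≠ j) :
    (Smax Φ i)ᗮ = Smin Φ j := by
  have : CompleteSpace (Smin Φ j) := (isClosed_Smin j).completeSpace_coe
  rw [← Smin_orthogonal hΦ hij, Submodule.orthogonal_orthogonal]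

/-- For `g` with Fourier support in `nⱼ ≥ 0`, `nᵢ < 0`, the projection of `[Φ; I] g` on
the scattering subspace is obtained by subtracting `[I; Φ*] q`, with `q` the part
of `Φ g` outside of `H²(Es)`. -/
theorem exists_scatteringProj_outElt (hΦ : IsSchur Φ) {i j : Fin 2} (hij : i ≠ j) {g : L2 E}
    (hg : g ∈ mixed E j) : ∃ q ∈ supportedIn Es {n | n i < 0},
      (scatteringProj Φ (outElt Φ g) : Model Φ) = outElt Φ g - inElt Φ q := by
  set q := boundaryMul Φ g - (H2 Es).starProjection (boundaryMul Φ g) with hq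
  have hq1 : q ∈ (H2 Es)ᗮ := Submodule.sub_starProjection_mem_orthogonal _
  have hg1 : g ∈ supportedIn E {n | 0 ≤ n j} := supportedIn_mono (fun n hn => hn.1) hg
  have hg2 : g ∈ supportedIn E {n | n i < 0} := supportedIn_mono (fun n hn => hn.2 i hij) hg
  have hq2 : q ∈ supportedIn Es {n | n i < 0} := by
    have h1 := hq1
    rw [supportedIn_orthogonal] at h1
    have h2 : q ∈ supportedIn Es {n | 0 ≤ n j} :=
      sub_mem (boundaryMul_mem_supportedIn hΦ j hg1) (supportedIn_mono
        (fun n (hn : ∀ l, 0 ≤ n l) => hn j) (Submodule.starProjection_apply_mem (H2 Es) _))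
    refine mem_supportedIn.2 fun n hn => ?_
    by_cases h3 : 0 ≤ n j
    · refine mem_supportedIn.1 h1 n ?_
      rw [Set.notMem_compl_iff]
      intro l
      by_cases hl : l = j
      · rwa [hl]
      · have e : l = i := fin_two_eq_of_ne hl hij
        rw [e]
        exact not_lt.1 hn
    · exact mem_supportedIn.1 h2 n h3
  refine ⟨q, hq2, ?_⟩
  have hneg : supportedIn E {n | n i < 0} ≤ (H2 E)ᗮ := by
    rw [supportedIn_orthogonal]
    exact supportedIn_mono fun n hn hc => absurd (hc i) (not_le.2 hn)
  refine Submodule.eq_starProjection_of_mem_orthogonal ((mem_scattering hΦ).2 ⟨?_, ?_⟩) ?_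
  · rw [map_sub, WithLp.sub_fst, toPair_inElt_fst hΦ, toPair_outElt_fst hΦ, hq, sub_sub_cancel]
    exact Submodule.starProjection_apply_mem _ _
  · rw [map_sub, WithLp.sub_snd, toPair_inElt_snd hΦ, toPair_outElt_snd hΦ]
    exact hneg (sub_mem hg2 (adjoint_boundaryMul_mem_supportedIn hΦ i hq2))
  · rw [sub_sub_cancel]
    exact inElt_mem_scattering_orthogonal hΦ hq1

theorem Smin_le {j : Fin 2} {N : Submodule ℂ (scattering Φ)} (hΦ : IsSchur Φ)
    (hN : IsClosed (N : Set (scattering Φ)))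
    (h : ∀ g ∈ mixed E j, scatteringProj Φ (outElt Φ g) ∈ N) : Smin Φ j ≤ N := by
  refine Submodule.topologicalClosure_minimal _ ?_ hN
  rw [inModel_map_colPhi hΦ]
  rintro _ ⟨_, ⟨g, hg, rfl⟩, rfl⟩
  exact h g hg

theorem Smin_le_Smax (hΦ : IsSchur Φ) (j : Fin 2) : Smin Φ j ≤ Smax Φ j := by
  obtain ⟨i, hij⟩ := exists_ne j
  refine Smin_le hΦ (isClosed_Smax Φ j) fun g hg => ?_
  obtain ⟨q, hq, h⟩ := exists_scatteringProj_outElt hΦ hij hg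
  rw [mem_Smax hΦ, h, map_sub, WithLp.sub_snd, toPair_inElt_snd hΦ, toPair_outElt_snd hΦ]
  have hset : {n : Fin 2 → ℤ | n i < 0} ⊆ {n | ∀ l, l ≠ j → n l < 0} := by
    intro n hn l hl
    have e : l = i := fin_two_eq_of_ne hl hij
    rw [e]
    exact hn
  exact sub_mem (supportedIn_mono (fun n hn => hn.2) hg)
    (supportedIn_mono hset (adjoint_boundaryMul_mem_supportedIn hΦ i hq))

theorem modelZ_mem_scattering {j : Fin 2} {F : scattering Φ} (hF : F ∈ Smax Φ j) :
    modelZ Φ j F ∈ scattering Φ := by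
  simp only [Smax, Submodule.mem_iInf] at hF
  have h := hF 1
  rw [pow_one] at h
  exact h

theorem scatteringProj_modelZ {j : Fin 2} {F : scattering Φ} (hF : F ∈ Smax Φ j) :
    (scatteringProj Φ (modelZ Φ j F) : Model Φ) = modelZ Φ j F :=
  (Submodule.starProjection_eq_self_iff (K := scattering Φ)).2 (modelZ_mem_scattering hF)

theorem scatteringProj_modelZ_mem_Smax {j : Fin 2} {F : scattering Φ} (hF : F ∈ Smax Φ j) :
    scatteringProj Φ (modelZ Φ j F) ∈ Smax Φ j := by
  simp only [Smax, Submodule.mem_iInf]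
  intro k
  change (modelZ Φ j ^ k) (scatteringProj Φ (modelZ Φ j F) : Model Φ) ∈ scattering Φ
  rw [scatteringProj_modelZ hF, ← mul_apply_eq_comp, ← pow_succ]
  simp only [Smax, Submodule.mem_iInf] at hF
  exact hF (k + 1)

/-- On the spanning vectors, `Z_j` commutes with the projection on `K_Φ`: the part `[I; Φ*] q` that
the projection removes from `[Φ; I] g` remains orthogonal to `K_Φ` after multiplication by `Z_j`. -/
theorem scatteringProj_modelZ_mem_Smin (hΦ : IsSchur Φ) {j : Fin 2} {F : scattering Φ}
    (hF : F ∈ Smin Φ j) : scatteringProj Φ (modelZ Φ j F) ∈ Smin Φ j := by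
  let U : scattering Φ →L[ℂ] scattering Φ :=
    scatteringProj Φ ∘L modelZ Φ j ∘L (scattering Φ).subtypeL
  have hle : Smin Φ j ≤ (Smin Φ j).comap U.toLinearMap := by
    refine Smin_le hΦ ((isClosed_Smin j).preimage U.continuous) fun g hg => ?_
    change scatteringProj Φ (modelZ Φ j (scatteringProj Φ (outElt Φ g) : Model Φ)) ∈ Smin Φ j
    obtain ⟨i, hij⟩ := exists_ne j
    obtain ⟨q, hq, h⟩ := exists_scatteringProj_outElt hΦ hij hg
    have hzq : mulMonomial Es (Pi.single j 1) q ∈ (H2 Es)ᗮ := by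
      rw [supportedIn_orthogonal]
      refine mem_supportedIn.2 fun n hn => ?_
      rw [Set.notMem_compl_iff] at hn
      rw [coeff_mulMonomial]
      refine mem_supportedIn.1 hq _ fun hc => ?_
      have h1 : (n - Pi.single j 1 : Fin 2 → ℤ) i < 0 := hc
      rw [Pi.sub_apply, Pi.single_eq_of_ne hij, sub_zero] at h1
      exact absurd (hn i) (not_le.2 h1)
    have hzg : mulMonomial E (Pi.single j 1) g ∈ mixed E j := by
      refine mem_supportedIn.2 fun n hn => ?_
      rw [coeff_mulMonomial]
      refine mem_supportedIn.1 hg _ fun hc => hn ⟨?_, fun l hl => ?_⟩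
      · have h1 := hc.1
        rw [Pi.sub_apply, Pi.single_eq_same] at h1
        linarith
      · have h1 := hc.2 l hl
        rwa [Pi.sub_apply, Pi.single_eq_of_ne hl, sub_zero] at h1
    rw [h, map_sub, modelZ_outElt hΦ, modelZ_inElt hΦ, map_sub,
      Submodule.orthogonalProjectionOnto_apply_of_mem_orthogonal
        (inElt_mem_scattering_orthogonal hΦ hzq), sub_zero]
    refine Submodule.le_topologicalClosure _ ?_
    rw [inModel_map_colPhi hΦ]
    exact ⟨_, ⟨_, hzg, rfl⟩, rfl⟩
  exact hle hF

end Model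

/-! ### Reproducing kernels of operator ranges -/

section Kernel

variable {H K X W : Type*} [NormedAddCommGroup H] [InnerProductSpace ℂ H] [CompleteSpace H]
  [NormedAddCommGroup K] [InnerProductSpace ℂ K] [CompleteSpace K]
  [NormedAddCommGroup W] [InnerProductSpace ℂ W] [CompleteSpace W]

/-- The reproducing kernel of the operator range of `T` is `T_z T_w*`, where `T_z` is `T` followed
by the evaluation at `z`: the map of `H` onto the operator range is a coisometry. -/
theorem kernel_operatorRange (T : H →L[ℂ] (X → W)) (z w : X) :
    RKHS.kernel (OperatorRange T) z w =
      (ContinuousLinearMap.proj z ∘L T) ∘L (ContinuousLinearMap.proj w ∘L T).adjoint := by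
  have h1 : ∀ x : X, (ContinuousLinearMap.proj x ∘L T : H →L[ℂ] W) =
      (ContinuousLinearMap.proj x ∘L RKHS.coeCLM ℂ) ∘L OperatorRange.mk T := by
    intro x
    ext y
    exact congrFun (OperatorRange.incl_mk T y).symm x
  have h2 : OperatorRange.mk T ∘L (OperatorRange.mk T).adjoint =
      ContinuousLinearMap.id ℂ (OperatorRange T) := by
    refine ContinuousLinearMap.ext fun F => ext_inner_left ℂ fun G => ?_
    have h3 : (OperatorRange.mk T).adjoint F = OperatorRange.preimage T F := by
      refine ext_inner_left ℂ fun y => ?_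
      rw [ContinuousLinearMap.adjoint_inner_right]
      exact Submodule.inner_orthogonalProjectionOnto_eq_of_mem_right _ _
    rw [ContinuousLinearMap.comp_apply, h3]
    exact Submodule.inner_orthogonalProjectionOnto_eq_of_mem_left _ _
  rw [h1 z, h1 w, ContinuousLinearMap.adjoint_comp, RKHS.kernel_apply, RKHS.kerFun, RKHS.kerFun,
    ContinuousLinearMap.adjoint_adjoint]
  ext v
  have h4 := congrArg (fun C : OperatorRange T →L[ℂ] OperatorRange T =>
    C ((ContinuousLinearMap.proj w ∘L RKHS.coeCLM ℂ).adjoint v)) h2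
  simp only [ContinuousLinearMap.comp_apply, ContinuousLinearMap.id_apply] at h4 ⊢
  rw [h4]

theorem isPositiveKernel_kernel [RKHS ℂ H X W] : IsPositiveKernel (RKHS.kernel H) := by
  intro N x η
  have h : ∑ i, ∑ j, inner ℂ (η i) (RKHS.kernel H (x i) (x j) (η j)) =
      inner ℂ (∑ i, RKHS.kerFun H (x i) (η i)) (∑ i, RKHS.kerFun H (x i) (η i)) := by
    simp only [sum_inner, inner_sum]
    rw [Finset.sum_comm]
    refine Finset.sum_congr rfl fun j _ => Finset.sum_congr rfl fun i _ => ?_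
    rw [RKHS.kernel_apply, ContinuousLinearMap.comp_apply, ContinuousLinearMap.adjoint_inner_right]
  rw [h, inner_self_eq_norm_sq_to_K]
  have h2 : 0 ≤ ‖∑ i, RKHS.kerFun H (x i) (η i)‖ ^ 2 := sq_nonneg _
  rw [← RCLike.ofReal_pow]
  exact RCLike.ofReal_nonneg.2 h2

/-- If the kernel of a reproducing kernel Hilbert space factors as `ℓ_z ℓ_w*` through a Hilbert
space `K`, then `k_w v ↦ ℓ_w* v` extends to an isometry into `K`. -/
theorem exists_isometry_of_kernel_eq [RKHS ℂ H X W] {l : X → K →L[ℂ] W}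
    (h : ∀ z w, RKHS.kernel H z w = l z ∘L (l w).adjoint) :
    ∃ U : H →ₗᵢ[ℂ] K, ∀ x v, U (RKHS.kerFun H x v) = (l x).adjoint v := by
  let L₁ : (X × W →₀ ℂ) →ₗ[ℂ] H :=
    Finsupp.linearCombination ℂ fun p : X × W => RKHS.kerFun H p.1 p.2
  let L₂ : (X × W →₀ ℂ) →ₗ[ℂ] K :=
    Finsupp.linearCombination ℂ fun p : X × W => (l p.1).adjoint p.2
  have hnorm : ∀ p, ‖L₂ p‖ = ‖L₁ p‖ := by
    intro p
    rw [@norm_eq_sqrt_re_inner ℂ, @norm_eq_sqrt_re_inner ℂ]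
    congr 2
    simp only [L₁, L₂, Finsupp.linearCombination_apply, Finsupp.sum, sum_inner, inner_sum,
      inner_smul_left, inner_smul_right]
    refine Finset.sum_congr rfl fun i _ => congrArg _ (Finset.sum_congr rfl fun j _ =>
      congrArg _ ?_)
    rw [← RKHS.kernel_inner, h, ContinuousLinearMap.comp_apply,
      ContinuousLinearMap.adjoint_inner_right (l i.1)]
  have hdense : DenseRange L₁ := by
    have h1 : (LinearMap.range L₁).topologicalClosure = ⊤ := by
      rw [← RKHS.kerFun_dense H, Finsupp.range_linearCombination]
      congr 2
      ext f
      simp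
    exact Submodule.dense_iff_topologicalClosure_eq_top.2 h1
  have hbound : ∃ C, ∀ p, ‖L₂ p‖ ≤ C * ‖L₁ p‖ := ⟨1, fun p => by rw [one_mul, hnorm]⟩
  have hext : ∀ p, L₂.extendOfNorm L₁ (L₁ p) = L₂ p :=
    LinearMap.extendOfNorm_eq hdense hbound
  refine ⟨⟨(L₂.extendOfNorm L₁).toLinearMap, fun x => ?_⟩, fun x v => ?_⟩
  · refine hdense.induction_on (p := fun x => ‖L₂.extendOfNorm L₁ x‖ = ‖x‖) x ?_ fun p => ?_
    · exact isClosed_eq (L₂.extendOfNorm L₁).continuous.norm continuous_norm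
    · rw [hext, hnorm]
  · have h1 := hext (Finsupp.single (x, v) 1)
    simp only [L₁, L₂, Finsupp.linearCombination_single, one_smul] at h1
    exact h1

/-- The compression `ℓ_z P ℓ_w*` of the kernel `ℓ_z ℓ_w*` to a subspace `N`, with `P` the projection
on `N`. -/
noncomputable def compressedKernel (l : X → K →L[ℂ] W) (N : Submodule ℂ K)
    [N.HasOrthogonalProjection] (z w : X) : W →L[ℂ] W :=
  l z ∘L N.starProjection ∘L (l w).adjoint

/-- If `T` is the restriction to `N` of `F ↦ (z ↦ ℓ_z F)`, its operator range has the kernel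
`ℓ_z P ℓ_w*`. -/
theorem kernel_operatorRange_restrict {l : X → K →L[ℂ] W} {N : Submodule ℂ K} [CompleteSpace N]
    {T : N →L[ℂ] (X → W)} (hT : ∀ (F : N) (x : X), T F x = l x F) (z w : X) :
    RKHS.kernel (OperatorRange T) z w = compressedKernel l N z w := by
  have h1 : ∀ x : X, (ContinuousLinearMap.proj x ∘L T : N →L[ℂ] W) = l x ∘L N.subtypeL :=
    fun x => ContinuousLinearMap.ext fun F => hT F x
  rw [kernel_operatorRange, h1 z, h1 w, ContinuousLinearMap.adjoint_comp _ N.subtypeL,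
    Submodule.adjoint_subtypeL]
  rfl

theorem starProjection_eq_add {M N : Submodule ℂ K} [M.HasOrthogonalProjection]
    [N.HasOrthogonalProjection] [(M ⊓ Nᗮ).HasOrthogonalProjection] (hNM : N ≤ M) (x : K) :
    M.starProjection x = N.starProjection x + (M ⊓ Nᗮ).starProjection x := by
  refine Submodule.eq_starProjection_of_mem_of_inner_eq_zero
    (add_mem (hNM (Submodule.starProjection_apply_mem _ _))
      (Submodule.starProjection_apply_mem (M ⊓ Nᗮ) x).1) fun m hm => ?_
  have h1 : m - N.starProjection m ∈ M ⊓ Nᗮ :=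
    ⟨sub_mem hm (hNM (Submodule.starProjection_apply_mem _ _)),
      Submodule.sub_starProjection_mem_orthogonal m⟩
  have h2 : N.starProjection m ∈ N := Submodule.starProjection_apply_mem _ _
  have e1 : inner ℂ (x - (N.starProjection x + (M ⊓ Nᗮ).starProjection x))
      (N.starProjection m) = 0 := by
    rw [← sub_sub, inner_sub_left, Submodule.starProjection_inner_eq_zero x _ h2,
      Submodule.inner_left_of_mem_orthogonal h2
        (Submodule.starProjection_apply_mem (M ⊓ Nᗮ) x).2, sub_zero]
  have e2 : inner ℂ (x - (N.starProjection x + (M ⊓ Nᗮ).starProjection x))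
      (m - N.starProjection m) = 0 := by
    rw [add_comm, ← sub_sub, inner_sub_left, Submodule.starProjection_inner_eq_zero x _ h1,
      Submodule.inner_right_of_mem_orthogonal (Submodule.starProjection_apply_mem N x) h1.2,
      sub_zero]
  rw [← add_sub_cancel (N.starProjection m) m, inner_add_right, e1, e2, add_zero]

theorem compressedKernel_eq_add (l : X → K →L[ℂ] W) {M N : Submodule ℂ K}
    [M.HasOrthogonalProjection] [N.HasOrthogonalProjection] [(M ⊓ Nᗮ).HasOrthogonalProjection]
    (hNM : N ≤ M) (z w : X) : compressedKernel l M z w =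
      compressedKernel l N z w + compressedKernel l (M ⊓ Nᗮ) z w := by
  ext v
  simp only [compressedKernel, ContinuousLinearMap.comp_apply, add_apply]
  rw [starProjection_eq_add hNM, map_add]

theorem compressedKernel_add_orthogonal (l : X → K →L[ℂ] W) {N L : Submodule ℂ K}
    [N.HasOrthogonalProjection] [L.HasOrthogonalProjection] (hL : Nᗮ = L) (z w : X) :
    l z ∘L (l w).adjoint = compressedKernel l N z w + compressedKernel l L z w := by
  subst hL
  ext v
  simp only [compressedKernel, ContinuousLinearMap.comp_apply, add_apply]
  rw [← map_add, Submodule.starProjection_add_starProjection_orthogonal]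

/-- The compression to the range of an isometry `U : N → K` for which `ℓ_z (U F) = c_z ℓ_z F` is
the compression to `N` multiplied by `c_z c̄_w`. -/
theorem compressedKernel_range_isometry (l : X → K →L[ℂ] W) {N R : Submodule ℂ K} [CompleteSpace N]
    [R.HasOrthogonalProjection] (U : N →ₗᵢ[ℂ] K) (hR : R = LinearMap.range U.toLinearMap)
    (c : X → ℂ) (hU : ∀ z (F : N), l z (U F) = c z • l z F) (z w : X) :
    compressedKernel l R z w = (c z * conj (c w)) • compressedKernel l N z w := by
  have hproj : ∀ x, R.starProjection x = U (U.toContinuousLinearMap.adjoint x) := by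
    intro x
    refine Submodule.eq_starProjection_of_mem_of_inner_eq_zero ?_ fun y hy => ?_
    · rw [hR]
      exact ⟨_, rfl⟩
    · rw [hR] at hy
      obtain ⟨F, rfl⟩ := hy
      have h1 : inner ℂ x (U F) = inner ℂ (U.toContinuousLinearMap.adjoint x) F :=
        (ContinuousLinearMap.adjoint_inner_left U.toContinuousLinearMap F x).symm
      rw [inner_sub_left]
      change inner ℂ x (U F) - inner ℂ (U (U.toContinuousLinearMap.adjoint x)) (U F) = 0
      rw [h1, LinearIsometry.inner_map_map, sub_self]
  have hadj : ∀ v, U.toContinuousLinearMap.adjoint ((l w).adjoint v) =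
      conj (c w) • N.orthogonalProjectionOnto ((l w).adjoint v) := by
    intro v
    refine ext_inner_left ℂ fun F => ?_
    rw [ContinuousLinearMap.adjoint_inner_right, ContinuousLinearMap.adjoint_inner_right,
      inner_smul_right, Submodule.inner_orthogonalProjectionOnto_eq_of_mem_left,
      ContinuousLinearMap.adjoint_inner_right]
    change inner ℂ (l w (U F)) v = _
    rw [hU, inner_smul_left]
  ext v
  simp only [compressedKernel, ContinuousLinearMap.comp_apply, smul_apply]
  rw [hproj, hU, hadj, ← smul_smul, Submodule.coe_smul, map_smul]
  rfl

end Kernel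

/-! ### The canonical kernels -/

section Defect

variable {G K : Type*} [NormedAddCommGroup G] [InnerProductSpace ℂ G] [CompleteSpace G]
  [NormedAddCommGroup K] [InnerProductSpace ℂ K] [CompleteSpace K]

/-- The quadratic form of the compression of `1 - T P T*` is `‖x‖² - ‖P T* x‖²`. -/
theorem isPositive_one_sub_compression {T : G →L[ℂ] K} (hT : ∀ f, ‖T f‖ ≤ ‖f‖)
    (M : Submodule ℂ G) [M.HasOrthogonalProjection] (N : Submodule ℂ K) [CompleteSpace N] :
    (1 - N.orthogonalProjectionOnto ∘L (T ∘L M.starProjection ∘L T.adjoint) ∘L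
      N.subtypeL).IsPositive := by
  have h : ∀ x : N, inner ℂ ((1 - N.orthogonalProjectionOnto ∘L
      (T ∘L M.starProjection ∘L T.adjoint) ∘L N.subtypeL) x) x =
      ((‖x‖ ^ 2 - ‖M.starProjection (T.adjoint x)‖ ^ 2 : ℝ) : ℂ) := by
    intro x
    have h1 : inner ℂ (N.orthogonalProjectionOnto (T (M.starProjection (T.adjoint x)))) x =
        inner ℂ (M.starProjection (T.adjoint x)) (M.starProjection (T.adjoint x)) := by
      rw [Submodule.inner_orthogonalProjectionOnto_eq_of_mem_right,
        ← ContinuousLinearMap.adjoint_inner_right, Submodule.inner_starProjection_left_eq_right,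
        Submodule.inner_starProjection_left_eq_right,
        Submodule.starProjection_eq_self_iff.2 (Submodule.starProjection_apply_mem _ _)]
    have h2 : (1 - N.orthogonalProjectionOnto ∘L (T ∘L M.starProjection ∘L T.adjoint) ∘L
        N.subtypeL) x = x - N.orthogonalProjectionOnto (T (M.starProjection (T.adjoint x))) := rfl
    rw [h2, inner_sub_left, h1, inner_self_eq_norm_sq_to_K, inner_self_eq_norm_sq_to_K]
    push_cast
    rfl
  have hT' : ∀ x, ‖T.adjoint x‖ ≤ ‖x‖ := by
    intro x
    refine (T.adjoint.le_opNorm x).trans (mul_le_of_le_one_left (norm_nonneg _) ?_)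
    rw [LinearIsometryEquiv.norm_map]
    exact ContinuousLinearMap.opNorm_le_bound _ zero_le_one fun f => by
      rw [one_mul]; exact hT f
  refine (LinearMap.isPositive_iff_complex _).2 fun x => ?_
  have h2 := h x
  refine ⟨?_, ?_⟩
  · refine Eq.trans ?_ h2.symm
    refine congrArg _ ?_
    exact congrArg Complex.re h2
  · refine le_of_le_of_eq ?_ (congrArg Complex.re h2).symm
    rw [Complex.ofReal_re, sub_nonneg]
    exact pow_le_pow_left₀ (norm_nonneg _) ((Submodule.norm_starProjection_apply_le _ _).trans
      (hT' _)) 2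

end Defect

section Canonical

variable {E Es : Type*} [NormedAddCommGroup E] [InnerProductSpace ℂ E] [CompleteSpace E]
  [NormedAddCommGroup Es] [InnerProductSpace ℂ Es] [CompleteSpace Es]
  [TopologicalSpace.SeparableSpace E] [TopologicalSpace.SeparableSpace Es]
  {Φ : (Fin 2 → ℂ) → (E →L[ℂ] Es)}

theorem isPositive_defect (hΦ : IsSchur Φ) :
    (1 - (H2 Es).orthogonalProjectionOnto ∘L (boundaryMul Φ ∘L (H2 E).starProjection ∘L
      (boundaryMul Φ).adjoint) ∘L (H2 Es).subtypeL).IsPositive :=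
  isPositive_one_sub_compression (norm_boundaryMul_le hΦ) _ _

/-- The Szegő kernel, compressed by `I - Φ P Φ*` with `P` the projection onto `H²(E)`, is the de
Branges–Rovnyak kernel. -/
theorem evalAt_defect (hΦ : IsSchur Φ) (z w : Bidisk) (e : Es) :
    evalAt Es z ((evalAt Es w).adjoint e - boundaryMul Φ ((H2 E).starProjection
      ((boundaryMul Φ).adjoint ((evalAt Es w).adjoint e)))) = dBRKernel Φ z w e := by
  rw [map_sub, evalAt_adjoint_evalAt, evalAt_boundaryMul_starProjection_adjoint hΦ, ← smul_sub]
  rfl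

/-- The operator range of the square root of the defect `D` has the kernel `ev_z D ev_w*`, with `ev`
the evaluations on `H²(Es)`. -/
theorem kernel_DBRSpace (hΦ : IsSchur Φ) (z w : Bidisk) :
    RKHS.kernel (DBRSpace Φ) z w = dBRKernel Φ z w := by
  rw [kernel_operatorRange]
  ext e
  have hadj : ∀ v, (ContinuousLinearMap.proj w ∘L toBidisk Es ∘L (H2 Es).subtypeL ∘L
      defectOp Φ).adjoint v =
      defectOp Φ ((H2 Es).orthogonalProjectionOnto ((evalAt Es w).adjoint v)) := by
    intro v
    refine ext_inner_left ℂ fun x => ?_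
    rw [ContinuousLinearMap.adjoint_inner_right]
    have h1 : inner ℂ (evalAt Es w (defectOp Φ x : L2 Es)) v =
        inner ℂ x (defectOp Φ ((H2 Es).orthogonalProjectionOnto ((evalAt Es w).adjoint v))) := by
      have h2 : inner ℂ (defectOp Φ x)
          ((H2 Es).orthogonalProjectionOnto ((evalAt Es w).adjoint v)) = inner ℂ x
          (defectOp Φ ((H2 Es).orthogonalProjectionOnto ((evalAt Es w).adjoint v))) :=
        (isPositive_opSqrt _).inner_left_eq_inner_right _ _
      rw [← h2, Submodule.inner_orthogonalProjectionOnto_eq_of_mem_left,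
        ContinuousLinearMap.adjoint_inner_right]
    exact h1
  rw [ContinuousLinearMap.comp_apply, hadj]
  set s := (evalAt Es w).adjoint e with hs
  have hsmem : s ∈ H2 Es := adjoint_evalAt_mem_H2 w e
  have hsq : defectOp Φ (defectOp Φ ((H2 Es).orthogonalProjectionOnto s)) =
      (H2 Es).orthogonalProjectionOnto s - (H2 Es).orthogonalProjectionOnto (boundaryMul Φ
        ((H2 E).starProjection ((boundaryMul Φ).adjoint
          ((H2 Es).orthogonalProjectionOnto s : L2 Es)))) :=
    opSqrt_opSqrt (isPositive_defect hΦ) _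
  have hp : ((H2 Es).orthogonalProjectionOnto s : L2 Es) = s :=
    Submodule.starProjection_eq_self_iff.2 hsmem
  rw [hp] at hsq
  have h3 : ((defectOp Φ (defectOp Φ ((H2 Es).orthogonalProjectionOnto s)) : H2 Es) : L2 Es) =
      s - (H2 Es).starProjection (boundaryMul Φ ((H2 E).starProjection
        ((boundaryMul Φ).adjoint s))) := by
    rw [hsq, Submodule.coe_sub, hp]
    rfl
  rw [Submodule.starProjection_eq_self_iff.2 (boundaryMul_mem_H2 hΦ
    (Submodule.starProjection_apply_mem _ _))] at h3
  rw [← evalAt_defect hΦ]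
  exact congrArg (evalAt Es z) h3

variable (Φ) in
/-- The value at `z` of the first component of an element of the scattering subspace. -/
noncomputable def scatteringEval (z : Bidisk) : scattering Φ →L[ℂ] Es :=
  evalAt Es z ∘L WithLp.fstL 2 ℂ (L2 Es) (L2 E) ∘L toPair Φ ∘L (scattering Φ).subtypeL

theorem scatteringEval_apply (z : Bidisk) (F : scattering Φ) :
    scatteringEval Φ z F = evalAt Es z (toPair Φ F).fst := rfl

theorem adjoint_scatteringEval (w : Bidisk) (e : Es) :
    (scatteringEval Φ w).adjoint e = scatteringProj Φ (inElt Φ ((evalAt Es w).adjoint e)) := by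
  refine ext_inner_right ℂ fun F => ?_
  rw [ContinuousLinearMap.adjoint_inner_left,
    Submodule.inner_orthogonalProjectionOnto_eq_of_mem_right, inner_inElt,
    ContinuousLinearMap.adjoint_inner_left]
  rfl

theorem scatteringEval_adjoint (hΦ : IsSchur Φ) (z w : Bidisk) :
    scatteringEval Φ z ∘L (scatteringEval Φ w).adjoint = dBRKernel Φ z w := by
  ext e
  rw [ContinuousLinearMap.comp_apply, adjoint_scatteringEval, scatteringEval_apply,
    scatteringProj_inElt_fst hΦ (adjoint_evalAt_mem_H2 w e), evalAt_defect hΦ]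

/-- The canonical isometry sends the kernel function `k_w e` of `H_Φ` to the element of `K_Φ`
representing the functional `F ↦ ⟪e, F₁(w)⟫`; both families have the same Gram matrix. -/
theorem exists_isCanonicalIsometry (hΦ : IsSchur Φ) :
    ∃ V : DBRSpace Φ →ₗᵢ[ℂ] scattering Φ, IsCanonicalIsometry V := by
  obtain ⟨V, hV⟩ := exists_isometry_of_kernel_eq (H := DBRSpace Φ) (l := scatteringEval Φ)
    fun z w => by rw [kernel_DBRSpace hΦ, scatteringEval_adjoint hΦ]
  have hadj : ∀ (F : scattering Φ) (z : Bidisk),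
      V.toContinuousLinearMap.adjoint F z = scatteringEval Φ z F := by
    intro F z
    refine ext_inner_left ℂ fun v => ?_
    rw [← RKHS.kerFun_inner, ContinuousLinearMap.adjoint_inner_right,
      ← ContinuousLinearMap.adjoint_inner_left]
    exact congrArg (fun G => inner ℂ G F) (hV z v)
  refine ⟨V, fun f => ?_, fun F => funext fun z => hadj F z⟩
  have h1 : V.toContinuousLinearMap.adjoint (V f) = f := by
    refine ext_inner_left ℂ fun g => ?_
    rw [ContinuousLinearMap.adjoint_inner_right]
    exact V.inner_map_map g f
  funext z
  rw [← h1]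
  have h2 := hadj (V f) z
  rw [h1] at h2 ⊢
  exact h2.symm

theorem rangeKernel_eq {V : DBRSpace Φ →ₗᵢ[ℂ] scattering Φ} (hV : IsCanonicalIsometry V)
    (N : Submodule ℂ (scattering Φ)) [CompleteSpace N] (z w : Bidisk) :
    rangeKernel V N z w = compressedKernel (scatteringEval Φ) N z w :=
  kernel_operatorRange_restrict (l := scatteringEval Φ) (T := restrictedAdjoint V N)
    (fun F x => congrFun (hV.2 (F : scattering Φ)) x) z w

theorem scatteringEval_modelZ (hΦ : IsSchur Φ) {j : Fin 2} {F G : scattering Φ}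
    (h : (G : Model Φ) = modelZ Φ j F) (z : Bidisk) :
    scatteringEval Φ z G = z.1 j • scatteringEval Φ z F := by
  have hF := ((mem_scattering hΦ).1 F.2).1
  rw [scatteringEval_apply, scatteringEval_apply, h, toPair_modelZ_fst hΦ]
  have h1 := evalAt_mulMonomial z (Pi.single j 1) hF
  have h2 : (fun i => ((Pi.single j 1 : Fin 2 → ℕ) i : ℤ)) = Pi.single j 1 := by
    funext i
    by_cases hi : i = j
    · subst hi; simp
    · simp [hi]
  have h3 : ∏ i, z.1 i ^ (Pi.single j 1 : Fin 2 → ℕ) i = z.1 j := by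
    rw [Finset.prod_eq_single j]
    · simp
    · intro i _ hi
      simp [hi]
    · simp
  rw [h2, h3] at h1
  exact h1

/-- Multiplication by `Z_j`, as an isometry from a subspace of `S_j^max` into `K_Φ`. -/
noncomputable def shiftIsometry (hΦ : IsSchur Φ) {j : Fin 2} {S : Submodule ℂ (scattering Φ)}
    (hS : S ≤ Smax Φ j) : S →ₗᵢ[ℂ] scattering Φ where
  toLinearMap := (scatteringProj Φ ∘L modelZ Φ j ∘L (scattering Φ).subtypeL ∘L
    S.subtypeL).toLinearMap
  norm_map' F := by
    change ‖(scatteringProj Φ (modelZ Φ j (F : scattering Φ)) : Model Φ)‖ = ‖(F : Model Φ)‖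
    rw [scatteringProj_modelZ (hS F.2), @norm_eq_sqrt_re_inner ℂ, inner_modelZ_modelZ hΦ,
      ← norm_eq_sqrt_re_inner]

theorem coe_shiftIsometry (hΦ : IsSchur Φ) {j : Fin 2} {S : Submodule ℂ (scattering Φ)}
    (hS : S ≤ Smax Φ j) (F : S) :
    (shiftIsometry hΦ hS F : Model Φ) = modelZ Φ j (F : scattering Φ) :=
  scatteringProj_modelZ (hS F.2)

theorem shifted_eq_range (hΦ : IsSchur Φ) {j : Fin 2} {S : Submodule ℂ (scattering Φ)}
    (hS : S ≤ Smax Φ j) : shifted j S = LinearMap.range (shiftIsometry hΦ hS).toLinearMap := by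
  ext G
  constructor
  · rintro ⟨F, hF, h⟩
    exact ⟨⟨F, hF⟩, Subtype.ext ((coe_shiftIsometry hΦ hS ⟨F, hF⟩).trans h)⟩
  · rintro ⟨F, rfl⟩
    exact ⟨F, F.2, (coe_shiftIsometry hΦ hS F).symm⟩

/-- If `Z_j` maps the closed subspace `S` of `S_j^max` into itself, the kernel of the wandering
subspace `S ⊖ Z_j S` is the kernel of `S` multiplied by `1 - z_j w̄_j`. -/
theorem compressedKernel_wandering (hΦ : IsSchur Φ) {j : Fin 2} {S : Submodule ℂ (scattering Φ)}
    [CompleteSpace S] [CompleteSpace (wandering j S)] (hS : S ≤ Smax Φ j)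
    (hZ : ∀ F ∈ S, scatteringProj Φ (modelZ Φ j F) ∈ S) (z w : Bidisk) :
    compressedKernel (scatteringEval Φ) (wandering j S) z w =
      (1 - z.1 j * conj (w.1 j)) • compressedKernel (scatteringEval Φ) S z w := by
  have hrange := shifted_eq_range hΦ hS
  have hle : shifted j S ≤ S := by
    rw [hrange]
    rintro _ ⟨F, rfl⟩
    exact hZ F F.2
  have : CompleteSpace (shifted j S) := by
    rw [hrange]
    exact ((shiftIsometry hΦ hS).isometry.isUniformInducing.isComplete_range).completeSpace_coe
  have : (S ⊓ (shifted j S)ᗮ).HasOrthogonalProjection :=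
    Submodule.HasOrthogonalProjection.ofCompleteSpace (wandering j S)
  have h1 : compressedKernel (scatteringEval Φ) S z w =
      compressedKernel (scatteringEval Φ) (shifted j S) z w +
        compressedKernel (scatteringEval Φ) (wandering j S) z w :=
    compressedKernel_eq_add (scatteringEval Φ) hle z w
  rw [compressedKernel_range_isometry (scatteringEval Φ) (shiftIsometry hΦ hS) hrange
    (fun x => x.1 j) (fun x F => scatteringEval_modelZ hΦ (coe_shiftIsometry hΦ hS F) x)] at h1
  rw [sub_smul, one_smul, eq_sub_iff_add_eq, add_comm]
  exact h1.symm

instance (j : Fin 2) : CompleteSpace (Smax Φ j) := (isClosed_Smax Φ j).completeSpace_coe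

instance (j : Fin 2) : CompleteSpace (Smin Φ j) := (isClosed_Smin j).completeSpace_coe

theorem Kmax_eq (hΦ : IsSchur Φ) {V : DBRSpace Φ →ₗᵢ[ℂ] scattering Φ} (hV : IsCanonicalIsometry V)
    (j : Fin 2) (z w : Bidisk) : Kmax V j z w =
      (1 - z.1 j * conj (w.1 j)) • compressedKernel (scatteringEval Φ) (Smax Φ j) z w := by
  rw [Kmax, rangeKernel_eq hV]
  exact compressedKernel_wandering hΦ le_rfl (fun F hF => scatteringProj_modelZ_mem_Smax hF) z w

theorem Kmin_eq (hΦ : IsSchur Φ) {V : DBRSpace Φ →ₗᵢ[ℂ] scattering Φ} (hV : IsCanonicalIsometry V)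
    (j : Fin 2) (z w : Bidisk) : Kmin V j z w =
      (1 - z.1 j * conj (w.1 j)) • compressedKernel (scatteringEval Φ) (Smin Φ j) z w := by
  rw [Kmin, rangeKernel_eq hV]
  exact compressedKernel_wandering hΦ (Smin_le_Smax hΦ j)
    (fun F hF => scatteringProj_modelZ_mem_Smin hΦ hF) z w

theorem dBRKernel_eq_add (hΦ : IsSchur Φ) {i j : Fin 2} (hij : i ≠ j) (z w : Bidisk) :
    dBRKernel Φ z w = compressedKernel (scatteringEval Φ) (Smax Φ i) z w +
      compressedKernel (scatteringEval Φ) (Smin Φ j) z w := by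
  rw [← scatteringEval_adjoint hΦ]
  exact compressedKernel_add_orthogonal _ (Smax_orthogonal hΦ hij) z w

theorem residualKernel_eq {V : DBRSpace Φ →ₗᵢ[ℂ] scattering Φ} (hΦ : IsSchur Φ)
    (hV : IsCanonicalIsometry V) (z w : Bidisk) :
    compressedKernel (scatteringEval Φ) (Smax Φ 0) z w =
      compressedKernel (scatteringEval Φ) (Smin Φ 0) z w + residualKernel V z w := by
  rw [residualKernel, rangeKernel_eq hV]
  have : (Smax Φ 0 ⊓ (Smin Φ 0)ᗮ).HasOrthogonalProjection :=
    Submodule.HasOrthogonalProjection.ofCompleteSpace (residual Φ)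
  exact compressedKernel_eq_add _ (Smin_le_Smax hΦ 0) z w

theorem one_sub_mul_conj_ne_zero (z w : Bidisk) (j : Fin 2) : 1 - z.1 j * conj (w.1 j) ≠ 0 := by
  intro h
  have h1 : ‖z.1 j * conj (w.1 j)‖ < 1 := by
    rw [norm_mul, RCLike.norm_conj]
    exact mul_lt_one_of_nonneg_of_lt_one_left (norm_nonneg _) (z.2 j) (w.2 j).le
  rw [← sub_eq_zero.1 h, norm_one] at h1
  exact lt_irrefl _ h1

/-- A decomposition of the de Branges–Rovnyak kernel along the two coordinates is a pair of Agler
kernels: multiply by `(1 - z₀ w̄₀) (1 - z₁ w̄₁)`. -/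
theorem isAglerKernels_of_dBRKernel_eq {K₁ K₂ : Bidisk → Bidisk → (Es →L[ℂ] Es)}
    (h₁ : IsPositiveKernel K₁) (h₂ : IsPositiveKernel K₂)
    (h : ∀ z w : Bidisk, dBRKernel Φ z w =
      (1 - z.1 0 * conj (w.1 0))⁻¹ • K₁ z w + (1 - z.1 1 * conj (w.1 1))⁻¹ • K₂ z w) :
    IsAglerKernels Φ K₁ K₂ := by
  refine ⟨h₁, h₂, fun z w => ?_⟩
  have h0 := one_sub_mul_conj_ne_zero z w 0
  have h1 := one_sub_mul_conj_ne_zero z w 1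
  have h2 := congrArg (fun A => ((1 - z.1 0 * conj (w.1 0)) * (1 - z.1 1 * conj (w.1 1))) • A)
    (h z w)
  simp only [dBRKernel, smul_add, smul_smul] at h2
  rw [mul_inv_cancel₀ (mul_ne_zero h0 h1), one_smul, mul_inv_cancel_right₀ h1,
    mul_right_comm, mul_inv_cancel₀ h0, one_mul] at h2
  rw [h2, add_comm]

end Canonical

end AglerDecomp

theorem mainTheorem2 {E Es : Type*}
    [NormedAddCommGroup E] [InnerProductSpace ℂ E] [CompleteSpace E]
    [TopologicalSpace.SeparableSpace E]
    [NormedAddCommGroup Es] [InnerProductSpace ℂ Es] [CompleteSpace Es]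
    [TopologicalSpace.SeparableSpace Es]
    (Φ : (Fin 2 → ℂ) → (E →L[ℂ] Es)) (hΦ : AglerDecomp.IsSchur Φ) :
    (∀ z w : AglerDecomp.Bidisk,
      RKHS.kernel (AglerDecomp.DBRSpace Φ) z w = AglerDecomp.dBRKernel Φ z w) ∧
    ∃ V : AglerDecomp.DBRSpace Φ →ₗᵢ[ℂ] AglerDecomp.scattering Φ,
      AglerDecomp.IsCanonicalIsometry V ∧
      AglerDecomp.IsAglerKernels Φ (AglerDecomp.Kmax V 0) (AglerDecomp.Kmin V 1) ∧
      AglerDecomp.IsAglerKernels Φ (AglerDecomp.Kmin V 0) (AglerDecomp.Kmax V 1) ∧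
      ∀ z w : AglerDecomp.Bidisk,
        AglerDecomp.dBRKernel Φ z w =
            (1 - z.1 0 * conj (w.1 0))⁻¹ • AglerDecomp.Kmax V 0 z w +
              (1 - z.1 1 * conj (w.1 1))⁻¹ • AglerDecomp.Kmin V 1 z w ∧
        AglerDecomp.dBRKernel Φ z w =
            (1 - z.1 0 * conj (w.1 0))⁻¹ • AglerDecomp.Kmin V 0 z w +
              (1 - z.1 1 * conj (w.1 1))⁻¹ • AglerDecomp.Kmax V 1 z w ∧
        AglerDecomp.dBRKernel Φ z w =
            (1 - z.1 0 * conj (w.1 0))⁻¹ • AglerDecomp.Kmin V 0 z w +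
              (1 - z.1 1 * conj (w.1 1))⁻¹ • AglerDecomp.Kmin V 1 z w +
              AglerDecomp.residualKernel V z w := by
  obtain ⟨V, hV⟩ := AglerDecomp.exists_isCanonicalIsometry hΦ
  have hmax : ∀ j (z w : AglerDecomp.Bidisk),
      (1 - z.1 j * conj (w.1 j))⁻¹ • AglerDecomp.Kmax V j z w =
        AglerDecomp.compressedKernel (AglerDecomp.scatteringEval Φ) (AglerDecomp.Smax Φ j) z w :=
    fun j z w => by
      rw [AglerDecomp.Kmax_eq hΦ hV, inv_smul_smul₀ (AglerDecomp.one_sub_mul_conj_ne_zero z w j)]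
  have hmin : ∀ j (z w : AglerDecomp.Bidisk),
      (1 - z.1 j * conj (w.1 j))⁻¹ • AglerDecomp.Kmin V j z w =
        AglerDecomp.compressedKernel (AglerDecomp.scatteringEval Φ) (AglerDecomp.Smin Φ j) z w :=
    fun j z w => by
      rw [AglerDecomp.Kmin_eq hΦ hV, inv_smul_smul₀ (AglerDecomp.one_sub_mul_conj_ne_zero z w j)]
  have h01 : ∀ z w : AglerDecomp.Bidisk, AglerDecomp.dBRKernel Φ z w =
      (1 - z.1 0 * conj (w.1 0))⁻¹ • AglerDecomp.Kmax V 0 z w +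
        (1 - z.1 1 * conj (w.1 1))⁻¹ • AglerDecomp.Kmin V 1 z w := fun z w => by
    rw [hmax, hmin, AglerDecomp.dBRKernel_eq_add hΦ zero_ne_one]
  have h10 : ∀ z w : AglerDecomp.Bidisk, AglerDecomp.dBRKernel Φ z w =
      (1 - z.1 0 * conj (w.1 0))⁻¹ • AglerDecomp.Kmin V 0 z w +
        (1 - z.1 1 * conj (w.1 1))⁻¹ • AglerDecomp.Kmax V 1 z w := fun z w => by
    rw [hmax, hmin, AglerDecomp.dBRKernel_eq_add hΦ one_ne_zero, add_comm]
  refine ⟨AglerDecomp.kernel_DBRSpace hΦ, V, hV,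
    AglerDecomp.isAglerKernels_of_dBRKernel_eq AglerDecomp.isPositiveKernel_kernel
      AglerDecomp.isPositiveKernel_kernel h01,
    AglerDecomp.isAglerKernels_of_dBRKernel_eq AglerDecomp.isPositiveKernel_kernel
      AglerDecomp.isPositiveKernel_kernel h10, fun z w => ⟨h01 z w, h10 z w, ?_⟩⟩
  rw [h01, hmax, AglerDecomp.residualKernel_eq hΦ hV, hmin, hmin]
  abel
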